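/- A finite presentation of a group is balanced if it has as many generators as relators, and a presentation is aspherical if its second homotopy module $\pi_2$ (the second homotopy group of its standard 2-complex; equivalently, the identity sequences among the relators modulo Peiffer equivalence) is trivial. A group $H$ is non-Hopfian if there is an epimorphism $H\to H$ with non-trivial kernel. **Proposition.** Let $S=BS(2,3)=\langle a,t\mid ta^2t^{-1}=a^3\rangle$. Let $B$ be an infinite group that has a balanced aspherical presentation and no non-trivial finite quotients, let $b\in B$ be an element of infinite order, and let $Q=S*_{\mathbb Z}B$ be the amalgamated free product in which $t\in S$ is identified with $b\in B$. Then $Q$ is non-Hopfian, $Q$ has a balanced aspherical presentation, and $Q$ has no non-trivial finite quotients. Moreover, $Q$ is torsion-free and $H_1(Q,\mathbb Z)=H_2(Q,\mathbb Z)=0$. -/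

import Mathlib

/-! ### Group presentations and asphericity

A presentation is given by a type `X` of generators and a family `r : R → FreeGroup X` of relators. -/

section Aspherical

variable {X R : Type*}

/-- The free group on the symbols `(w, ρ)`, with `w` a word in the generators and `ρ` (the index of)
a relator; `(w, ρ)` stands for the formal conjugate `w r_ρ w⁻¹`.  Its elements are the (reduced)
sequences of formal conjugates of relators and of their inverses. -/
abbrev RelatorSequence (X R : Type*) : Type _ := FreeGroup (FreeGroup X × R)

/-- The homomorphism which multiplies out a sequence in the free group `FreeGroup X`:
`(w, ρ) ↦ w r_ρ w⁻¹`. -/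
def RelatorSequence.boundary (r : R → FreeGroup X) : RelatorSequence X R →* FreeGroup X :=
  FreeGroup.lift fun p => p.1 * r p.2 * p.1⁻¹

/-- The action of `FreeGroup X` on sequences, `u • (w, ρ) = (u w, ρ)`. -/
def RelatorSequence.translate (u : FreeGroup X) : RelatorSequence X R →* RelatorSequence X R :=
  FreeGroup.map fun p => (u * p.1, p.2)

/-- The normal subgroup generated by the Peiffer elements `h k h⁻¹ (∂h • k)⁻¹`. -/
def peifferSubgroup (r : R → FreeGroup X) : Subgroup (RelatorSequence X R) :=
  Subgroup.normalClosure
    {x | ∃ h k : RelatorSequence X R,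
      x = h * k * h⁻¹ * (RelatorSequence.translate (RelatorSequence.boundary r h) k)⁻¹}

/-- The second homotopy module `π₂` of the presentation `⟨X | r⟩`: identity sequences (sequences
whose product is `1` in the free group) modulo Peiffer equivalence.  It is the second homotopy
group of the standard 2-complex of the presentation. -/
abbrev PresentationPi2 (r : R → FreeGroup X) : Type _ :=
  (RelatorSequence.boundary r).ker ⧸ (peifferSubgroup r).subgroupOf (RelatorSequence.boundary r).ker

/-- A presentation is aspherical if its `π₂` is trivial. -/
def IsAsphericalPresentation (r : R → FreeGroup X) : Prop :=
  Subsingleton (PresentationPi2 r)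

end Aspherical

/-- A finite presentation of the group `G`, with generators and relators indexed by
`Fin numGens` and `Fin numRels`. -/
structure FinPresentation (G : Type*) [Group G] where
  numGens : ℕ
  numRels : ℕ
  rel : Fin numRels → FreeGroup (Fin numGens)
  iso : PresentedGroup (Set.range rel) ≃* G

/-- As many generators as relators. -/
def FinPresentation.IsBalanced {G : Type*} [Group G] (P : FinPresentation G) : Prop :=
  P.numGens = P.numRels

def FinPresentation.IsAspherical {G : Type*} [Group G] (P : FinPresentation G) : Prop :=
  IsAsphericalPresentation P.rel

/-! ### Properties of groups -/

/-- There is an epimorphism `G → G` with non-trivial kernel. -/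
def IsNonHopfian (G : Type*) [Group G] : Prop :=
  ∃ f : G →* G, Function.Surjective f ∧ f.ker ≠ ⊥

/-- Every finite quotient of `G` is trivial. -/
def NoNontrivialFiniteQuotients (G : Type*) [Group G] : Prop :=
  ∀ N : Subgroup G, N.Normal → Finite (G ⧸ N) → Subsingleton (G ⧸ N)

/-! ### The group `S = BS(2,3)` and the amalgam `Q` -/

/-- Names of the two generators of `BS(2,3)`. -/
inductive BSGen : Type
  | a
  | t

/-- `BS(2,3) = ⟨a, t | t a² t⁻¹ = a³⟩`. -/
abbrev BS23 : Type :=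
  PresentedGroup ({FreeGroup.of BSGen.t * FreeGroup.of BSGen.a ^ 2 * (FreeGroup.of BSGen.t)⁻¹ *
    (FreeGroup.of BSGen.a ^ 3)⁻¹} : Set (FreeGroup BSGen))

/-- The stable letter `t` of `BS(2,3)`. -/
def BS23.t : BS23 := PresentedGroup.of BSGen.t

section Amalgam

variable (B : Type) [Group B]

/-- The two factors `S = BS(2,3)` (index `false`) and `B` (index `true`). -/
def AmalgamFactor : Bool → Type
  | false => BS23
  | true => B

instance AmalgamFactor.instGroup : ∀ i : Bool, Group (AmalgamFactor B i)
  | false => inferInstanceAs (Group BS23)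
  | true => inferInstanceAs (Group B)

variable {B}

/-- The two maps out of the infinite cyclic group: the generator goes to `t ∈ S`, respectively
to `b ∈ B`. -/
def amalgamMap (b : B) : ∀ i : Bool, Multiplicative ℤ →* AmalgamFactor B i
  | false => zpowersHom BS23 BS23.t
  | true => zpowersHom B b

/-- `Q = S *_ℤ B`, the pushout of `S ← ℤ → B` which identifies `t` with `b`. -/
abbrev AmalgamQ (b : B) : Type := Monoid.PushoutI (amalgamMap b)

end Amalgam

/-!
The amalgam `Q` has the presentation `⟨X, a | R, w a² w⁻¹ a⁻³⟩`, where `⟨X | R⟩` is the given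
presentation of `B` and `w` is a word representing `b`: the generator `t` is eliminated. It is
balanced because `⟨X | R⟩` is.

*Asphericity.* For a presentation of `G`, Fox calculus gives the cellular chain complex
`ℤ[G]^R → ℤ[G]^X → ℤ[G]` of the Cayley complex. It is exact in the middle, and the presentation is
aspherical if and only if the Jacobian matrix `ℤ[G]^R → ℤ[G]^X` is injective
(`IsAsphericalPresentation.foxBoundaryTwo_injective`, `isAsphericalPresentation_of_injective`).
One direction rests on the fact that an element of the kernel `N` of `FreeGroup X → G` whose Fox
derivative vanishes is in `[N, N]`; the other one on the freeness of `N` (Nielsen–Schreier), which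
splits the free crossed module as a product of `N` and the central subgroup `π₂`. For `Q` the Jacobian
matrix is block triangular (`AmalgamQ.foxBoundaryTwo_injective`). One diagonal block is the matrix
of `B`, which stays injective over `ℤ[Q]` by restriction to cosets of `B`. The other one is the
element `t (1 + a) - (1 + a + a²)` of `ℤ[S]`, which is not a right zero divisor, as is seen from the
grading of `S` by the exponent sum of `t` (`eq_zero_of_mul_foxDeriv_relator_eq_zero`).

*Torsion.* The chain complex of an aspherical presentation is a free resolution of length two, which
is incompatible with the periodic cohomology of finite cyclic groups
(`IsAsphericalPresentation.eq_one_of_isOfFinOrder`).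

*Quotients.* A finite quotient of `Q` kills `B`, hence `t`, hence `a` because `a² = a³` in it.
The endomorphism `a ↦ a²` of `Q` is surjective, and it kills the commutator of `t a t⁻¹` and `a`,
which is not trivial by Britton's lemma in `S` and the injectivity of `S → Q`.

*Homology.* A finitely generated group without non-trivial finite quotients is perfect. For a balanced
presentation of a perfect group `G` the matrix `ℤ^R → ℤ^X` of exponent sums is surjective, hence
injective. Every 2-cycle `c` comes from an element `n` of `N ∩ [F, F]`, with `F = FreeGroup X`, and
injectivity forces `n ∈ [F, N]`; so the lift of `n` to the central extension of `G` by the group of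
2-chains modulo boundaries is trivial. This lift is the class of `c`
(`subsingleton_groupHomology_two`).
-/

open scoped MonoidAlgebra

/-! ### Additive maps out of group rings -/

section GroupRing

variable {G M : Type*} [Group G]

/-- The additive map `ℤ[G] → M` with prescribed values on the elements of `G`. -/
noncomputable def groupRingLift [AddCommGroup M] (f : G → M) : ℤ[G] →+ M :=
  (Finsupp.liftAddHom fun g => zmultiplesHom M (f g)).comp
    (MonoidAlgebra.coeffAddEquiv (R := ℤ) (M := G)).toAddMonoidHom

theorem groupRingLift_of [AddCommGroup M] (f : G → M) (g : G) :
    groupRingLift f (MonoidAlgebra.of ℤ G g) = f g := by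
  simp [groupRingLift, MonoidAlgebra.of]

theorem groupRing_addHom_ext [AddCommGroup M] {f f' : ℤ[G] →+ M}
    (h : ∀ g, f (MonoidAlgebra.of ℤ G g) = f' (MonoidAlgebra.of ℤ G g)) : f = f' := by
  refine MonoidAlgebra.addMonoidHom_ext fun g => DFunLike.congr_fun
    (f := f.comp (MonoidAlgebra.singleAddHom g)) (g := f'.comp (MonoidAlgebra.singleAddHom g))
    (AddMonoidHom.ext_int ?_)
  simpa using h g

theorem groupRing_finsupp_addHom_ext {X : Type*} [AddCommGroup M] {f f' : (X →₀ ℤ[G]) →+ M}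
    (h : ∀ x g, f (Finsupp.single x (MonoidAlgebra.of ℤ G g)) =
      f' (Finsupp.single x (MonoidAlgebra.of ℤ G g))) : f = f' := by
  refine Finsupp.addHom_ext' fun x => groupRing_addHom_ext fun g => ?_
  simpa using h x g

end GroupRing

/-! ### Fox derivatives and the chain complex of the Cayley complex -/

section Fox

variable {X G : Type*} [Group G]

/-- The action of `G` on the additive group of a `ℤ[G]`-module. -/
noncomputable def groupRingMulAut (G M : Type*) [Group G] [AddCommGroup M] [Module ℤ[G] M] :
    G →* MulAut (Multiplicative M) where
  toFun g :=
    { toFun := fun m => Multiplicative.ofAdd (MonoidAlgebra.of ℤ G g • m.toAdd)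
      invFun := fun m => Multiplicative.ofAdd (MonoidAlgebra.of ℤ G g⁻¹ • m.toAdd)
      left_inv := fun m => by
        simp only [toAdd_ofAdd, smul_smul, ← map_mul, inv_mul_cancel, map_one, one_smul,
          ofAdd_toAdd]
      right_inv := fun m => by
        simp only [toAdd_ofAdd, smul_smul, ← map_mul, mul_inv_cancel, map_one, one_smul,
          ofAdd_toAdd]
      map_mul' := fun m m' => by simp only [toAdd_mul, smul_add, ofAdd_add] }
  map_one' := by ext m; simp [-MonoidAlgebra.of_apply]
  map_mul' g h := by ext m; simp [smul_smul]

/-- The homomorphism to `(X →₀ ℤ[G]) ⋊ G` whose first component is the Fox derivative. -/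
noncomputable def foxHom (π : FreeGroup X →* G) :
    FreeGroup X →* Multiplicative (X →₀ ℤ[G]) ⋊[groupRingMulAut G (X →₀ ℤ[G])] G :=
  FreeGroup.lift fun x => ⟨Multiplicative.ofAdd (Finsupp.single x 1), π (.of x)⟩

/-- The Fox derivative: the crossed homomorphism sending the generator `x` to the
basis element `e_x` of the free module `X →₀ ℤ[G]`. -/
noncomputable def foxDeriv (π : FreeGroup X →* G) (f : FreeGroup X) : X →₀ ℤ[G] :=
  (foxHom π f).left.toAdd

variable (π : FreeGroup X →* G)

theorem foxHom_right (f : FreeGroup X) : (foxHom π f).right = π f := by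
  have : SemidirectProduct.rightHom.comp (foxHom π) = π := by
    ext x; simp [foxHom]
  exact DFunLike.congr_fun this f

@[simp] theorem foxDeriv_of (x : X) : foxDeriv π (.of x) = Finsupp.single x 1 := by
  simp [foxDeriv, foxHom]

theorem foxDeriv_mul (f f' : FreeGroup X) :
    foxDeriv π (f * f') = foxDeriv π f + MonoidAlgebra.of ℤ G (π f) • foxDeriv π f' := by
  unfold foxDeriv
  rw [map_mul, SemidirectProduct.mul_left, foxHom_right]
  rfl

@[simp] theorem foxDeriv_one : foxDeriv π 1 = 0 := by
  simp [foxDeriv]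

theorem foxDeriv_inv (f : FreeGroup X) :
    foxDeriv π f⁻¹ = - (MonoidAlgebra.of ℤ G (π f)⁻¹ • foxDeriv π f) := by
  have h := foxDeriv_mul π f⁻¹ f
  rw [inv_mul_cancel, foxDeriv_one, map_inv] at h
  exact eq_neg_of_add_eq_zero_left h.symm

theorem foxDeriv_mul_inv {u v : FreeGroup X} (h : π u = π v) :
    foxDeriv π (u * v⁻¹) = foxDeriv π u - foxDeriv π v := by
  rw [foxDeriv_mul, foxDeriv_inv, smul_neg, smul_smul, ← map_mul, h, mul_inv_cancel, map_one,
    one_smul, sub_eq_add_neg]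

theorem foxDeriv_conj {w u : FreeGroup X} (h : π u = 1) :
    foxDeriv π (w * u * w⁻¹) = MonoidAlgebra.of ℤ G (π w) • foxDeriv π u := by
  rw [foxDeriv_mul_inv π (by simp [h]), foxDeriv_mul]
  abel

/-- The boundary operator `e_x ↦ [x] - 1` from 1-chains to 0-chains of the Cayley complex. -/
noncomputable def foxBoundaryOne : (X →₀ ℤ[G]) →ₗ[ℤ[G]] ℤ[G] :=
  Finsupp.linearCombination _ fun x => MonoidAlgebra.of ℤ G (π (.of x)) - 1

theorem foxBoundaryOne_single (x : X) (c : ℤ[G]) :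
    foxBoundaryOne π (.single x c) = c * (MonoidAlgebra.of ℤ G (π (.of x)) - 1) := by
  simp [foxBoundaryOne]

/-- The fundamental formula of Fox calculus. -/
theorem foxBoundaryOne_foxDeriv (f : FreeGroup X) :
    foxBoundaryOne π (foxDeriv π f) = MonoidAlgebra.of ℤ G (π f) - 1 := by
  induction f using FreeGroup.induction_on with
  | C1 => simp [-MonoidAlgebra.of_apply]
  | of x => rw [foxDeriv_of, foxBoundaryOne_single, one_mul]
  | inv_of x h =>
    rw [foxDeriv_inv, map_neg, map_smul, h, smul_eq_mul, mul_sub, ← map_mul, map_inv π,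
      inv_mul_cancel, map_one, mul_one, neg_sub]
  | mul x y hx hy =>
    rw [foxDeriv_mul, map_add, map_smul, hx, hy, smul_eq_mul, mul_sub, ← map_mul, map_mul]
    simp [-MonoidAlgebra.of_apply]

variable {R : Type*} (r : R → FreeGroup X)

/-- The boundary operator from 2-chains to 1-chains of the Cayley complex: the Jacobian matrix
of Fox derivatives of the relators. -/
noncomputable def foxBoundaryTwo : (R →₀ ℤ[G]) →ₗ[ℤ[G]] (X →₀ ℤ[G]) :=
  Finsupp.linearCombination _ fun ρ => foxDeriv π (r ρ)

theorem foxBoundaryTwo_single (ρ : R) (c : ℤ[G]) :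
    foxBoundaryTwo π r (.single ρ c) = c • foxDeriv π (r ρ) := by
  simp [foxBoundaryTwo]

/-- The 2-chain carried by a sequence of formal conjugates of relators: `(w, ρ) ↦ [w] e_ρ`. -/
noncomputable def relatorChain : RelatorSequence X R →* Multiplicative (R →₀ ℤ[G]) :=
  FreeGroup.lift fun p => Multiplicative.ofAdd (.single p.2 (MonoidAlgebra.of ℤ G (π p.1)))

@[simp] theorem relatorChain_of (p : FreeGroup X × R) :
    relatorChain π (.of p) = Multiplicative.ofAdd (.single p.2 (MonoidAlgebra.of ℤ G (π p.1))) := by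
  simp [relatorChain]

namespace RelatorSequence

@[simp] theorem boundary_of (p : FreeGroup X × R) : boundary r (.of p) = p.1 * r p.2 * p.1⁻¹ := by
  simp [boundary]

@[simp] theorem translate_of (u : FreeGroup X) (p : FreeGroup X × R) :
    translate u (.of p) = FreeGroup.of (u * p.1, p.2) := by
  simp [translate]

theorem boundary_translate (u : FreeGroup X) (h : RelatorSequence X R) :
    boundary r (translate u h) = u * boundary r h * u⁻¹ := by
  have : (boundary r).comp (translate u) = (MulAut.conj u).toMonoidHom.comp (boundary r) := by
    ext p; simp [mul_assoc]
  simpa using DFunLike.congr_fun this h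

theorem range_boundary :
    (boundary r).range = Subgroup.normalClosure (Set.range r) := by
  apply le_antisymm
  · rw [MonoidHom.range_eq_map, ← FreeGroup.closure_range_of, MonoidHom.map_closure,
      Subgroup.closure_le]
    rintro _ ⟨_, ⟨p, rfl⟩, rfl⟩
    rw [SetLike.mem_coe]
    rw [boundary_of]
    exact Subgroup.normalClosure_normal.conj_mem _
      (Subgroup.subset_normalClosure (Set.mem_range_self _)) _
  · have : (boundary r).range.Normal :=
      ⟨by rintro _ ⟨h, rfl⟩ u; exact ⟨translate u h, boundary_translate r u h⟩⟩
    apply Subgroup.normalClosure_le_normal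
    rintro _ ⟨ρ, rfl⟩
    exact ⟨.of (1, ρ), by simp⟩

theorem peifferSubgroup_le_ker : peifferSubgroup r ≤ (boundary r).ker := by
  apply Subgroup.normalClosure_le_normal
  rintro _ ⟨h, k, rfl⟩
  simp [boundary_translate, MonoidHom.mem_ker]

end RelatorSequence

theorem relatorChain_translate (u : FreeGroup X) (h : RelatorSequence X R) :
    (relatorChain π (RelatorSequence.translate u h)).toAdd =
      MonoidAlgebra.of ℤ G (π u) • (relatorChain π h).toAdd := by
  have : (relatorChain π).comp (RelatorSequence.translate u) =
      (groupRingMulAut G (R →₀ ℤ[G]) (π u)).toMonoidHom.comp (relatorChain (R := R) π) := by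
    ext p : 1
    simp [groupRingMulAut, Finsupp.smul_single]
  exact congrArg Multiplicative.toAdd (DFunLike.congr_fun this h)

variable {π r} (hr : ∀ ρ, π (r ρ) = 1)
include hr

theorem map_boundary (h : RelatorSequence X R) : π (RelatorSequence.boundary r h) = 1 := by
  have : π.comp (RelatorSequence.boundary r) = 1 := by
    ext p; simp [hr]
  exact DFunLike.congr_fun this h

theorem foxBoundaryTwo_relatorChain (h : RelatorSequence X R) :
    foxBoundaryTwo π r (relatorChain π h).toAdd = foxDeriv π (RelatorSequence.boundary r h) := by
  induction h using FreeGroup.induction_on with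
  | C1 => simp [-MonoidAlgebra.of_apply]
  | of p => simp [foxBoundaryTwo_single, foxDeriv_conj π (hr _)]
  | inv_of p h =>
    rw [map_inv, toAdd_inv, map_neg, h, map_inv, foxDeriv_inv, map_boundary hr]
    simp [-MonoidAlgebra.of_apply]
  | mul x y hx hy =>
    rw [map_mul, toAdd_mul, map_add, hx, hy, map_mul, foxDeriv_mul, map_boundary hr]
    simp [-MonoidAlgebra.of_apply]

theorem relatorChain_peiffer {h : RelatorSequence X R} (hh : h ∈ peifferSubgroup r) :
    relatorChain π h = 1 := by
  have : peifferSubgroup r ≤ (relatorChain (R := R) π).ker := by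
    apply Subgroup.normalClosure_le_normal
    rintro _ ⟨h, k, rfl⟩
    apply Multiplicative.toAdd.injective
    rw [map_mul, map_inv, toAdd_mul, toAdd_inv, relatorChain_translate, map_boundary hr]
    simp [-MonoidAlgebra.of_apply]
  exact this hh

end Fox

/-! ### Exactness of the chain complex -/

section FoxExact

variable {X G : Type*} [Group G] {π : FreeGroup X →* G} (hπ : Function.Surjective π)

/-- The augmentation `ℤ[G] → ℤ`. -/
noncomputable def groupRingAugmentation (G : Type*) [Group G] : ℤ[G] →+ ℤ :=
  groupRingLift fun _ => 1

/-- The contraction of 0-chains to 1-chains: `g` goes to the Fox derivative of a chosen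
word representing `g`. -/
noncomputable def foxContraction : ℤ[G] →+ (X →₀ ℤ[G]) :=
  groupRingLift fun g => foxDeriv π (Function.surjInv hπ g)

/-- The contraction exhibits the augmentation ideal as the image of the first boundary operator. -/
theorem foxBoundaryOne_foxContraction (a : ℤ[G]) :
    foxBoundaryOne π (foxContraction hπ a) = a - groupRingAugmentation G a • (1 : ℤ[G]) := by
  have : (foxBoundaryOne π).toAddMonoidHom.comp (foxContraction hπ) =
      AddMonoidHom.id _ -
        (zmultiplesHom _ (1 : ℤ[G])).comp (groupRingAugmentation G) := by
    refine groupRing_addHom_ext fun g => ?_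
    simp only [AddMonoidHom.comp_apply, foxContraction, groupRingLift_of,
      LinearMap.toAddMonoidHom_coe, foxBoundaryOne_foxDeriv, Function.surjInv_eq,
      AddMonoidHom.sub_apply, groupRingAugmentation, AddMonoidHom.id_apply, zmultiplesHom_apply,
      one_smul]
  exact DFunLike.congr_fun this a

theorem groupRingAugmentation_foxBoundaryOne (v : X →₀ ℤ[G]) :
    groupRingAugmentation G (foxBoundaryOne π v) = 0 := by
  have : (groupRingAugmentation G).comp (foxBoundaryOne π).toAddMonoidHom = 0 := by
    refine groupRing_finsupp_addHom_ext fun x g => ?_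
    simp only [AddMonoidHom.comp_apply, LinearMap.toAddMonoidHom_coe, foxBoundaryOne_single,
      mul_sub, mul_one, ← map_mul, map_sub, groupRingAugmentation, groupRingLift_of, sub_self,
      AddMonoidHom.zero_apply]
  exact DFunLike.congr_fun this v

/-- The element of `ker π` read off along `f`, starting at `g` and closing up with the chosen
words for the two end points. -/
noncomputable def schreierElement (g : G) (f : FreeGroup X) : π.ker :=
  ⟨Function.surjInv hπ g * f * (Function.surjInv hπ (g * π f))⁻¹, by
    simp [MonoidHom.mem_ker, Function.surjInv_eq]⟩

theorem schreierElement_mul (g : G) (f f' : FreeGroup X) :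
    schreierElement hπ g (f * f') =
      schreierElement hπ g f * schreierElement hπ (g * π f) f' := by
  ext
  simp [schreierElement, mul_assoc]

theorem schreierElement_one (g : G) : schreierElement hπ g 1 = 1 := by
  ext
  simp [schreierElement]

/-- The map from 1-chains to the abelianized kernel given by the Schreier generators. -/
noncomputable def schreierHom : (X →₀ ℤ[G]) →+ Additive (Abelianization π.ker) :=
  Finsupp.liftAddHom fun x => groupRingLift fun g =>
    Additive.ofMul (Abelianization.of (schreierElement hπ g (.of x)))

theorem schreierHom_single (x : X) (g : G) :
    schreierHom hπ (.single x (MonoidAlgebra.of ℤ G g)) =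
      Additive.ofMul (Abelianization.of (schreierElement hπ g (.of x))) := by
  simp only [schreierHom, Finsupp.liftAddHom_apply_single, groupRingLift_of]

/-- The map given by the Schreier generators inverts the Fox derivative: on the path with label `f`
starting at `g` it takes the element of `ker π` read off along this path. -/
theorem schreierHom_foxDeriv (f : FreeGroup X) (g : G) :
    schreierHom hπ (MonoidAlgebra.of ℤ G g • foxDeriv π f) =
      Additive.ofMul (Abelianization.of (schreierElement hπ g f)) := by
  have key : ∀ (u v : FreeGroup X) (g : G),
      schreierHom hπ (MonoidAlgebra.of ℤ G g • foxDeriv π (u * v)) =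
        schreierHom hπ (MonoidAlgebra.of ℤ G g • foxDeriv π u) +
        schreierHom hπ (MonoidAlgebra.of ℤ G (g * π u) • foxDeriv π v) := by
    intro u v g
    rw [foxDeriv_mul, smul_add, map_add, smul_smul, ← map_mul]
  induction f using FreeGroup.induction_on generalizing g with
  | C1 => rw [foxDeriv_one, smul_zero, map_zero, schreierElement_one, map_one, ofMul_one]
  | of x => rw [foxDeriv_of, Finsupp.smul_single, smul_eq_mul, mul_one, schreierHom_single]
  | inv_of x h =>
    have h1 := key (FreeGroup.of x)⁻¹ (FreeGroup.of x) g
    have h2 := schreierElement_mul hπ g (FreeGroup.of x)⁻¹ (FreeGroup.of x)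
    rw [inv_mul_cancel, schreierElement_one] at h2
    rw [inv_mul_cancel, foxDeriv_one, smul_zero, map_zero, h] at h1
    rw [eq_neg_of_add_eq_zero_left h1.symm, eq_inv_of_mul_eq_one_left h2.symm, map_inv,
      map_inv Abelianization.of, ofMul_inv]
  | mul x y hx hy =>
    rw [key, hx, hy, schreierElement_mul, map_mul, ofMul_mul]

include hπ in
/-- An element of `ker π` whose Fox derivative vanishes lies in the commutator subgroup of
`ker π`. -/
theorem mem_commutator_ker_of_foxDeriv_eq_zero {n : π.ker}
    (hn : foxDeriv π (n : FreeGroup X) = 0) :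
    n ∈ commutator π.ker := by
  have h := schreierHom_foxDeriv hπ (n : FreeGroup X) 1
  rw [hn, smul_zero, map_zero] at h
  have h1 : schreierElement hπ 1 (n : FreeGroup X) ∈ commutator π.ker := by
    rw [← Abelianization.ker_of, MonoidHom.mem_ker]
    exact (Additive.ofMul.injective h).symm
  have hs : Function.surjInv hπ 1 ∈ π.ker := Function.surjInv_eq hπ 1
  have h2 : schreierElement hπ 1 (n : FreeGroup X) =
      (⟨_, hs⟩ : π.ker) * n * (⟨_, hs⟩ : π.ker)⁻¹ := by
    ext
    simp [schreierElement, MonoidHom.mem_ker.mp n.2]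
  rw [h2] at h1
  have := (inferInstance : (commutator π.ker).Normal).conj_mem _ h1 (⟨_, hs⟩ : π.ker)⁻¹
  simpa [mul_assoc] using this

/-- The Fox derivative is a homomorphism on `ker π`. -/
noncomputable def foxDerivKer (π : FreeGroup X →* G) : π.ker →* Multiplicative (X →₀ ℤ[G]) where
  toFun n := Multiplicative.ofAdd (foxDeriv π n)
  map_one' := by simp
  map_mul' n m := by
    rw [Subgroup.coe_mul, foxDeriv_mul, MonoidHom.mem_ker.mp n.2, map_one, one_smul, ofAdd_add]

include hπ in
/-- The 1-cycles are the Fox derivatives of elements of `ker π`. -/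
theorem exists_foxDeriv_eq {v : X →₀ ℤ[G]} (hv : foxBoundaryOne π v = 0) :
    ∃ n : π.ker, foxDeriv π (n : FreeGroup X) = v := by
  -- the Fox derivative of `schreierHom` and the contraction form a chain homotopy
  have : (MonoidHom.toAdditiveLeft (Abelianization.lift (foxDerivKer π))).comp (schreierHom hπ) =
      AddMonoidHom.id _ - (foxContraction hπ).comp (foxBoundaryOne π).toAddMonoidHom := by
    refine groupRing_finsupp_addHom_ext fun x g => ?_
    have h1 : π (Function.surjInv hπ g * .of x) = π (Function.surjInv hπ (g * π (.of x))) := by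
      simp [Function.surjInv_eq]
    simp only [AddMonoidHom.comp_apply, schreierHom_single, MonoidHom.coe_toAdditiveLeft,
      Function.comp_apply, toMul_ofMul, Abelianization.lift_apply_of, AddMonoidHom.sub_apply,
      AddMonoidHom.id_apply, LinearMap.toAddMonoidHom_coe, foxBoundaryOne_single, mul_sub, mul_one,
      ← map_mul, map_sub, foxContraction, groupRingLift_of]
    change foxDeriv π (Function.surjInv hπ g * .of x * (Function.surjInv hπ (g * π (.of x)))⁻¹) = _
    rw [foxDeriv_mul_inv π h1, foxDeriv_mul, foxDeriv_of, Finsupp.smul_single, smul_eq_mul,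
      mul_one, Function.surjInv_eq hπ g]
    abel
  have h := DFunLike.congr_fun this v
  obtain ⟨n, hn⟩ := QuotientGroup.mk_surjective (schreierHom hπ v).toMul
  refine ⟨n, ?_⟩
  simp only [AddMonoidHom.comp_apply, AddMonoidHom.sub_apply, LinearMap.toAddMonoidHom_coe, hv,
    map_zero, sub_zero, AddMonoidHom.id_apply] at h
  rw [← h]
  change _ = Multiplicative.toAdd (Abelianization.lift (foxDerivKer π) (schreierHom hπ v).toMul)
  rw [← hn]
  rfl

variable {R : Type*} {r : R → FreeGroup X}

include hπ in
theorem relatorChain_surjective :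
    Function.Surjective fun h : RelatorSequence X R => (relatorChain π h).toAdd := by
  intro v
  induction v using Finsupp.induction_linear with
  | zero => exact ⟨1, by simp⟩
  | add v w hv hw =>
    obtain ⟨h, rfl⟩ := hv
    obtain ⟨k, rfl⟩ := hw
    exact ⟨h * k, by simp⟩
  | single ρ c =>
    induction c using MonoidAlgebra.induction_linear with
    | zero => exact ⟨1, by simp⟩
    | add v w hv hw =>
      obtain ⟨h, hv⟩ := hv
      obtain ⟨k, hw⟩ := hw
      exact ⟨h * k, by simp only [map_mul, toAdd_mul, Finsupp.single_add]; rw [← hv, ← hw]⟩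
    | single g n =>
      obtain ⟨w, rfl⟩ := hπ g
      refine ⟨.of (w, ρ) ^ n, ?_⟩
      simp

variable (hker : π.ker = Subgroup.normalClosure (Set.range r))
include hker

theorem map_relator_eq_one (ρ : R) : π (r ρ) = 1 := by
  rw [← MonoidHom.mem_ker, hker]
  exact Subgroup.subset_normalClosure (Set.mem_range_self _)

include hπ in
/-- The cellular chain complex of the Cayley complex is exact in degree one. -/
theorem exists_foxBoundaryTwo_eq {v : X →₀ ℤ[G]} (hv : foxBoundaryOne π v = 0) :
    ∃ u, foxBoundaryTwo π r u = v := by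
  obtain ⟨⟨n, hn⟩, rfl⟩ := exists_foxDeriv_eq hπ hv
  rw [hker, ← RelatorSequence.range_boundary] at hn
  obtain ⟨h, rfl⟩ := hn
  exact ⟨_, foxBoundaryTwo_relatorChain (map_relator_eq_one hker) h⟩

include hπ in
/-- For an aspherical presentation the second boundary operator is injective: the boundary of
a relator sequence whose 2-chain is a cycle has Fox derivative zero, so it lies in the commutator
subgroup of `ker π`, which lifts to commutators of relator sequences. -/
theorem IsAsphericalPresentation.foxBoundaryTwo_injective (hr : IsAsphericalPresentation r) :
    Function.Injective (foxBoundaryTwo π r) := by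
  have hrel := map_relator_eq_one hker
  rw [injective_iff_map_eq_zero]
  intro v hv
  obtain ⟨h, rfl⟩ := relatorChain_surjective (R := R) hπ v
  have hrange : (RelatorSequence.boundary r).range = π.ker := by
    rw [hker, RelatorSequence.range_boundary]
  have hmem : RelatorSequence.boundary r h ∈ π.ker := map_boundary hrel h
  have hcomm := mem_commutator_ker_of_foxDeriv_eq_zero hπ (n := ⟨_, hmem⟩)
    (by rw [← hv]; exact (foxBoundaryTwo_relatorChain hrel h).symm)
  -- the boundary of `h` is the boundary of a product of commutators of sequences
  have hcomm' : RelatorSequence.boundary r h ∈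
      (commutator (RelatorSequence X R)).map (RelatorSequence.boundary r) := by
    rw [commutator_def, Subgroup.map_commutator, ← MonoidHom.range_eq_map, hrange,
      ← Subgroup.map_subtype_commutator]
    exact ⟨_, hcomm, rfl⟩
  obtain ⟨k, hk, hkh⟩ := hcomm'
  have hk1 : relatorChain π k = 1 :=
    Abelianization.commutator_subset_ker (relatorChain (R := R) π) hk
  have hpf : h * k⁻¹ ∈ peifferSubgroup r := by
    have hm : h * k⁻¹ ∈ (RelatorSequence.boundary r).ker := by
      rw [MonoidHom.mem_ker, map_mul, map_inv, hkh, mul_inv_cancel]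
    have := QuotientGroup.subsingleton_iff.mp hr
    have h3 : (⟨_, hm⟩ : (RelatorSequence.boundary r).ker) ∈
      (peifferSubgroup r).subgroupOf (RelatorSequence.boundary r).ker := this ▸ Subgroup.mem_top _
    exact h3
  have h4 := relatorChain_peiffer hrel hpf
  rw [map_mul, map_inv, hk1, inv_one, mul_one] at h4
  simp [h4]

end FoxExact

/-! ### The asphericity criterion -/

section AsphericityCriterion

/-- A surjection onto a free group with central kernel is injective on the commutator subgroup:
it splits, so that the source is the product of its kernel and a free group. -/
theorem eq_one_of_mem_commutator_of_central {C N : Type*} [Group C] [Group N] [IsFreeGroup N]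
    (p : C →* N) (hp : Function.Surjective p) (hcent : p.ker ≤ Subgroup.center C) {c : C}
    (hc : c ∈ commutator C) (hc1 : p c = 1) : c = 1 := by
  obtain ⟨s, hs⟩ : ∃ s : N →* C, ∀ n, p (s n) = n := by
    refine ⟨IsFreeGroup.lift fun x => Function.surjInv hp (IsFreeGroup.of x), fun n => ?_⟩
    have : p.comp (IsFreeGroup.lift fun x => Function.surjInv hp (IsFreeGroup.of x)) =
        MonoidHom.id N := by
      refine IsFreeGroup.ext_hom fun x => ?_
      simp [Function.surjInv_eq]
    exact DFunLike.congr_fun this n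
  have hz : ∀ c : C, c * (s (p c))⁻¹ ∈ Subgroup.center C := fun c => hcent <| by
    simp [MonoidHom.mem_ker, hs]
  -- the projection of `C` to the central subgroup `ker p` along the splitting
  let κ : C →* Subgroup.center C :=
    MonoidHom.mk' (fun c => ⟨c * (s (p c))⁻¹, hz c⟩) fun c d => by
      ext
      have := Subgroup.mem_center_iff.mp (hz d) (s (p c))⁻¹
      simp only [map_mul, mul_inv_rev, Subgroup.coe_mul]
      calc c * d * ((s (p d))⁻¹ * (s (p c))⁻¹) = c * (d * (s (p d))⁻¹ * (s (p c))⁻¹) := by group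
        _ = _ := by rw [← this]; group
  have hle : commutator C ≤ κ.ker := by
    rw [commutator_def, Subgroup.commutator_le]
    intro x _ y _
    rw [MonoidHom.mem_ker, map_commutatorElement, commutatorElement_eq_one_iff_mul_comm]
    exact Subtype.ext (Subgroup.mem_center_iff.mp (κ y).2 (κ x))
  have h : κ c = 1 := hle hc
  simpa [κ, hc1] using congrArg Subtype.val h

variable {X G R : Type*} [Group G] {π : FreeGroup X →* G} (hπ : Function.Surjective π)
  {r : R → FreeGroup X} (hker : π.ker = Subgroup.normalClosure (Set.range r))

instance peifferSubgroup_normal (r : R → FreeGroup X) : (peifferSubgroup r).Normal :=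
  Subgroup.normalClosure_normal

/-- The free crossed module of a presentation: relator sequences modulo Peiffer equivalence. -/
abbrev PeifferQuotient (r : R → FreeGroup X) : Type _ :=
  RelatorSequence X R ⧸ peifferSubgroup r

theorem PeifferQuotient.mk_translate (r : R → FreeGroup X) (h k : RelatorSequence X R) :
    (RelatorSequence.translate (RelatorSequence.boundary r h) k : PeifferQuotient r) =
      h * k * (h : PeifferQuotient r)⁻¹ := by
  have : h * k * h⁻¹ * (RelatorSequence.translate (RelatorSequence.boundary r h) k)⁻¹ ∈
      peifferSubgroup r := Subgroup.subset_normalClosure ⟨h, k, rfl⟩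
  rw [← QuotientGroup.eq_one_iff] at this
  exact (mul_inv_eq_one.mp this).symm

include hπ hker in
/-- The abelianized free crossed module is the module of 2-chains, so that a relator sequence
with trivial 2-chain is a product of commutators modulo Peiffer equivalence. -/
theorem mk_mem_commutator_of_relatorChain_eq_one {h : RelatorSequence X R}
    (hh : relatorChain π h = 1) : (h : PeifferQuotient r) ∈ commutator (PeifferQuotient r) := by
  let q : RelatorSequence X R →* Abelianization (PeifferQuotient r) :=
    Abelianization.of.comp (QuotientGroup.mk' _)
  let β : (R →₀ ℤ[G]) →+ Additive (Abelianization (PeifferQuotient r)) :=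
    Finsupp.liftAddHom fun ρ => groupRingLift fun g =>
      Additive.ofMul (q (.of (Function.surjInv hπ g, ρ)))
  have key : (AddMonoidHom.toMultiplicativeLeft β).comp (relatorChain π) = q := by
    ext ⟨w, ρ⟩
    change (β (relatorChain π (.of (w, ρ))).toAdd).toMul = q (.of (w, ρ))
    rw [relatorChain_of]
    simp only [toAdd_ofAdd, β, Finsupp.liftAddHom_apply_single, groupRingLift_of, toMul_ofMul]
    -- the two words differ by the boundary of some sequence, and translating by a boundary
    -- is a conjugation in the free crossed module
    have hm : w * (Function.surjInv hπ (π w))⁻¹ ∈ (RelatorSequence.boundary r).range := by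
      rw [RelatorSequence.range_boundary, ← hker, MonoidHom.mem_ker]
      simp [Function.surjInv_eq]
    obtain ⟨k, hk⟩ := hm
    have h1 := PeifferQuotient.mk_translate r k (.of (Function.surjInv hπ (π w), ρ))
    rw [hk, RelatorSequence.translate_of, inv_mul_cancel_right] at h1
    simp only [q, MonoidHom.comp_apply, QuotientGroup.mk'_apply, h1, map_mul, map_inv]
    rw [mul_comm, inv_mul_cancel_left]
  have h2 : q h = 1 := by
    rw [← key, MonoidHom.comp_apply, hh, map_one]
  rw [← Abelianization.ker_of]
  exact h2

include hπ hker in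
/-- A presentation is aspherical as soon as its second Fox boundary operator is injective. -/
theorem isAsphericalPresentation_of_injective
    (hinj : Function.Injective (foxBoundaryTwo π r)) : IsAsphericalPresentation r := by
  have hrel := map_relator_eq_one hker
  refine QuotientGroup.subsingleton_iff.mpr (eq_top_iff.mpr ?_)
  rintro ⟨h, hh⟩ -
  rw [Subgroup.mem_subgroupOf, ← QuotientGroup.eq_one_iff]
  rw [MonoidHom.mem_ker] at hh
  have h0 : relatorChain π h = 1 := by
    apply Multiplicative.toAdd.injective
    apply hinj
    rw [foxBoundaryTwo_relatorChain hrel, hh]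
    simp
  have hc := mk_mem_commutator_of_relatorChain_eq_one hπ hker h0
  let p : PeifferQuotient r →* (RelatorSequence.boundary r).range :=
    QuotientGroup.lift (peifferSubgroup r) (RelatorSequence.boundary r).rangeRestrict (by
      rw [MonoidHom.ker_rangeRestrict]
      exact RelatorSequence.peifferSubgroup_le_ker r)
  have hpmk : ∀ k : RelatorSequence X R,
      (p (k : PeifferQuotient r) : FreeGroup X) = RelatorSequence.boundary r k := fun k => rfl
  refine eq_one_of_mem_commutator_of_central p ?_ ?_ hc (Subtype.ext (by rw [hpmk, hh]; rfl))
  · rintro ⟨_, k, rfl⟩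
    exact ⟨(k : PeifferQuotient r), rfl⟩
  -- the Peiffer relations make the kernel central
  · intro c hc
    obtain ⟨c, rfl⟩ := QuotientGroup.mk_surjective c
    rw [Subgroup.mem_center_iff]
    intro d
    obtain ⟨d, rfl⟩ := QuotientGroup.mk_surjective d
    have h1 : RelatorSequence.boundary r c = 1 := by
      rw [← hpmk, MonoidHom.mem_ker.mp hc]; rfl
    have h2 := PeifferQuotient.mk_translate r c d
    have h3 : RelatorSequence.translate (R := R) (1 : FreeGroup X) = MonoidHom.id _ := by
      ext; simp
    rw [h1, h3, MonoidHom.id_apply] at h2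
    exact eq_mul_inv_iff_mul_eq.mp h2

end AsphericityCriterion

/-! ### Torsion-freeness -/

section CyclicCohomology

variable {A M : Type*} [Ring A] [AddCommGroup M] [Module A M]

/-- The module `M`, with the cyclic group of order `n` acting through the powers of `u`, is induced
from the trivial group by means of `τ`: every `m` is the sum of the `uⁱ τ(u⁻ⁱ m)`. For a free action
`τ` is the projection to the span of a transversal. The inverse `u⁻ⁱ` is written `uⁿ⁻ⁱ`, so that `u`
need not be a unit; the condition is meant for `uⁿ = 1`. -/
def IsInducedBy (u : A) (n : ℕ) (τ : M →+ M) : Prop :=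
  ∀ m, ∑ i ∈ Finset.range n, u ^ i • τ (u ^ (n - i) • m) = m

variable {u : A} {n : ℕ} {τ : M →+ M}

/-- On an induced module the invariants are norms. -/
theorem IsInducedBy.exists_norm_eq (hτ : IsInducedBy u n τ) {m : M} (hm : u • m = m) :
    ∃ y : M, (∑ i ∈ Finset.range n, u ^ i) • y = m := by
  have hpow : ∀ k : ℕ, u ^ k • m = m := fun k => by
    induction k with
    | zero => simp
    | succ k ih => rw [pow_succ, mul_smul, hm, ih]
  refine ⟨τ m, ?_⟩
  conv_rhs => rw [← hτ m]
  rw [Finset.sum_smul]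
  simp only [hpow]

/-- On an induced module the kernel of the norm is the image of `u - 1`. -/
theorem IsInducedBy.exists_sub_eq (hτ : IsInducedBy u n τ) {m : M}
    (hm : (∑ i ∈ Finset.range n, u ^ i) • m = 0) : ∃ y : M, (u - 1) • y = m := by
  have h0 : ∑ i ∈ Finset.range n, τ (u ^ (n - i) • m) = 0 := by
    rw [← map_sum, ← Finset.sum_smul]
    have : ∑ i ∈ Finset.range n, u ^ (n - i) = u * ∑ i ∈ Finset.range n, u ^ i := by
      rw [← Finset.sum_range_reflect, Finset.mul_sum]
      refine Finset.sum_congr rfl fun i hi => ?_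
      rw [Finset.mem_range] at hi
      rw [← pow_succ']
      congr 1
      omega
    rw [this, mul_smul, hm, smul_zero, map_zero]
  refine ⟨∑ i ∈ Finset.range n, (∑ j ∈ Finset.range i, u ^ j) • τ (u ^ (n - i) • m), ?_⟩
  rw [Finset.smul_sum]
  simp only [smul_smul, mul_geom_sum, sub_smul, one_smul]
  rw [Finset.sum_sub_distrib, h0, sub_zero]
  exact hτ m

theorem IsInducedBy.finsupp {τ : A →+ A} (hτ : IsInducedBy u n τ) (I : Type*) :
    IsInducedBy u n (Finsupp.mapRange.addMonoidHom τ : (I →₀ A) →+ (I →₀ A)) := by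
  intro m
  ext i
  simpa [Finsupp.finsetSum_apply] using hτ (m i)

/-- If `ε : A → ℤ` has a resolution `F₂ → F₁ → A` of length two by modules induced along the
action of the cyclic group of order `n`, then `n` divides `1`. This is the contradiction between
`H³(ℤ/n, ℤ) = 0` for dimension reasons and the periodicity of the cohomology of `ℤ/n`. -/
theorem dvd_one_of_resolution_length_two {F₁ F₂ : Type*} [AddCommGroup F₁] [AddCommGroup F₂]
    [Module A F₁] [Module A F₂] (hu : u ^ n = 1)
    {ε : A →+ ℤ} {d₁ : F₁ →ₗ[A] A} {d₂ : F₂ →ₗ[A] F₁}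
    (hε : ∀ a, ε (u * a) = ε a) (hε1 : ε 1 = 1)
    (hex0 : ∀ a, ε a = 0 → ∃ v, d₁ v = a) (hcomp : ∀ v, ε (d₁ v) = 0)
    (hex1 : ∀ v, d₁ v = 0 → ∃ w, d₂ w = v) (hcomp' : ∀ w, d₁ (d₂ w) = 0)
    (hinj : Function.Injective d₂)
    {τ₀ : A →+ A} {τ₁ : F₁ →+ F₁} {τ₂ : F₂ →+ F₂}
    (h₀ : IsInducedBy u n τ₀) (h₁ : IsInducedBy u n τ₁) (h₂ : IsInducedBy u n τ₂) :
    (n : ℤ) ∣ 1 := by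
  set ν : A := ∑ i ∈ Finset.range n, u ^ i with hν
  have hνu : ν * (u - 1) = 0 := by rw [hν, geom_sum_mul, hu, sub_self]
  have huν : (u - 1) * ν = 0 := by rw [hν, mul_geom_sum, hu, sub_self]
  obtain ⟨x₁, hx₁⟩ := hex0 (u - 1) (by rw [map_sub, ← mul_one u, hε, sub_self])
  obtain ⟨x₂, hx₂⟩ := hex1 (ν • x₁) (by rw [map_smul, hx₁, smul_eq_mul, hνu])
  obtain ⟨y₂, hy₂⟩ := h₂.exists_norm_eq (m := x₂) (by
    have h : (u - 1) • x₂ = u • x₂ - x₂ := by rw [sub_smul, one_smul]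
    rw [← sub_eq_zero, ← h]
    apply hinj
    rw [map_smul, hx₂, smul_smul, huν, zero_smul, map_zero])
  obtain ⟨y₁, hy₁⟩ := h₁.exists_sub_eq (m := x₁ - d₂ y₂) (by
    rw [smul_sub, ← map_smul, hy₂, hx₂, sub_self])
  obtain ⟨y₀, hy₀⟩ := h₀.exists_norm_eq (m := 1 - d₁ y₁) (by
    have h : (u - 1) • (1 - d₁ y₁) = u • (1 - d₁ y₁) - (1 - d₁ y₁) := by rw [sub_smul, one_smul]
    rw [← sub_eq_zero, ← h, smul_sub, ← map_smul, hy₁, map_sub, hcomp', hx₁]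
    simp)
  have hpow : ∀ (k : ℕ) (a : A), ε (u ^ k * a) = ε a := fun k a => by
    induction k with
    | zero => simp
    | succ k ih => rw [pow_succ', mul_assoc, hε, ih]
  refine ⟨ε y₀, ?_⟩
  have := congrArg ε hy₀
  rw [map_sub, hcomp, hε1, sub_zero, smul_eq_mul, Finset.sum_mul, map_sum] at this
  simp only [hpow, Finset.sum_const, Finset.card_range, nsmul_eq_mul] at this
  exact this.symm

end CyclicCohomology

section TorsionFree

variable {G : Type*} [Group G]

/-- The group ring is induced along left multiplication by an element of finite order: project
onto the span of a transversal of the cosets of the cyclic subgroup. -/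
theorem exists_isInducedBy_groupRing (g : G) (hg : IsOfFinOrder g) :
    ∃ τ : ℤ[G] →+ ℤ[G], IsInducedBy (MonoidAlgebra.of ℤ G g) (orderOf g) τ := by
  classical
  let rep : G → G := fun h => (Quotient.mk (QuotientGroup.rightRel (Subgroup.zpowers g)) h).out
  have hrep_mul : ∀ (i : ℕ) h, rep (g ^ i * h) = rep h := fun i h => by
    refine congrArg Quotient.out (Quotient.sound ?_)
    refine QuotientGroup.rightRel_apply.mpr ?_
    simp only [mul_inv_rev, mul_inv_cancel_left]
    exact inv_mem (Subgroup.pow_mem _ (Subgroup.mem_zpowers g) i)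
  have hrep_ex : ∀ h, ∃ i < orderOf g, h = g ^ i * rep h := fun h => by
    have h1 : h * (rep h)⁻¹ ∈ Subgroup.zpowers g :=
      QuotientGroup.rightRel_apply.mp (Quotient.mk_out (s := QuotientGroup.rightRel _) h)
    rw [hg.mem_zpowers_iff_mem_range_orderOf, Finset.mem_image] at h1
    obtain ⟨i, hi, h2⟩ := h1
    exact ⟨i, Finset.mem_range.mp hi, by rw [h2, inv_mul_cancel_right]⟩
  let τ : ℤ[G] →+ ℤ[G] := groupRingLift fun h => if rep h = h then MonoidAlgebra.of ℤ G h else 0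
  refine ⟨τ, fun m => ?_⟩
  let Φ : ℤ[G] →+ ℤ[G] := ∑ i ∈ Finset.range (orderOf g),
    (AddMonoidHom.mulLeft (MonoidAlgebra.of ℤ G g ^ i)).comp
      (τ.comp (AddMonoidHom.mulLeft (MonoidAlgebra.of ℤ G g ^ (orderOf g - i))))
  suffices h : Φ = AddMonoidHom.id _ by
    have := DFunLike.congr_fun h m
    rw [AddMonoidHom.finsetSum_apply] at this
    exact this
  refine groupRing_addHom_ext fun h => ?_
  obtain ⟨j, hj, hjh⟩ := hrep_ex h
  have hterm : ∀ i ∈ Finset.range (orderOf g),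
      MonoidAlgebra.of ℤ G g ^ i *
        τ (MonoidAlgebra.of ℤ G g ^ (orderOf g - i) * MonoidAlgebra.of ℤ G h) =
      if i = j then MonoidAlgebra.of ℤ G h else 0 := by
    intro i hi
    rw [Finset.mem_range] at hi
    have hinv : g ^ i * g ^ (orderOf g - i) = 1 := by
      rw [← pow_add, Nat.add_sub_cancel' hi.le, pow_orderOf_eq_one]
    rw [← map_pow, ← map_pow, ← map_mul, groupRingLift_of, hrep_mul]
    by_cases hij : i = j
    · subst hij
      have : rep h = g ^ (orderOf g - i) * h := by
        rw [← mul_right_inj (g ^ i), ← mul_assoc, hinv, one_mul, ← hjh]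
      rw [if_pos this, if_pos rfl, ← map_mul, ← mul_assoc, hinv, one_mul]
    · rw [if_neg hij, if_neg, mul_zero]
      intro h1
      apply hij
      have h2 : g ^ i * rep h = g ^ j * rep h := by
        rw [← hjh]
        conv_lhs => rw [h1]
        rw [← mul_assoc, hinv, one_mul]
      exact pow_injOn_Iio_orderOf hi hj (mul_right_cancel h2)
  simp only [Φ, AddMonoidHom.finsetSum_apply]
  refine (Finset.sum_congr rfl hterm).trans ?_
  rw [Finset.sum_ite_eq', if_pos (Finset.mem_range.mpr hj)]
  rfl

variable {X R : Type*} {π : FreeGroup X →* G} (hπ : Function.Surjective π)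
  {r : R → FreeGroup X} (hker : π.ker = Subgroup.normalClosure (Set.range r))

include hπ hker in
/-- A group with an aspherical presentation is torsion-free, because the cellular chain complex of
the Cayley complex is a free resolution of length two. -/
theorem IsAsphericalPresentation.eq_one_of_isOfFinOrder (hr : IsAsphericalPresentation r)
    (g : G) (hg : IsOfFinOrder g) : g = 1 := by
  obtain ⟨τ, hτ⟩ := exists_isInducedBy_groupRing g hg
  have hrel := map_relator_eq_one hker
  have h := dvd_one_of_resolution_length_two (u := MonoidAlgebra.of ℤ G g) (n := orderOf g)
    (ε := groupRingAugmentation G) (d₁ := foxBoundaryOne π) (d₂ := foxBoundaryTwo π r)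
    (by rw [← map_pow, pow_orderOf_eq_one, map_one]) ?_ ?_ ?_
    groupRingAugmentation_foxBoundaryOne (fun v => exists_foxBoundaryTwo_eq hπ hker) ?_
    (hr.foxBoundaryTwo_injective hπ hker) hτ (hτ.finsupp X) (hτ.finsupp R)
  · rw [← orderOf_eq_one_iff]
    exact_mod_cast Int.eq_one_of_dvd_one (by positivity) h
  · intro a
    have : (groupRingAugmentation G).comp (AddMonoidHom.mulLeft (MonoidAlgebra.of ℤ G g)) =
        groupRingAugmentation G := groupRing_addHom_ext fun h => by
      rw [AddMonoidHom.comp_apply, AddMonoidHom.coe_mulLeft, ← map_mul, groupRingAugmentation,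
        groupRingLift_of, groupRingLift_of]
    exact DFunLike.congr_fun this a
  · rw [← map_one (MonoidAlgebra.of ℤ G), groupRingAugmentation, groupRingLift_of]
  · intro a ha
    exact ⟨foxContraction hπ a, by
      rw [foxBoundaryOne_foxContraction, ha, zero_smul, sub_zero]⟩
  · intro w
    obtain ⟨h, rfl⟩ := relatorChain_surjective (R := R) hπ w
    dsimp only
    rw [foxBoundaryTwo_relatorChain hrel, foxBoundaryOne_foxDeriv, map_boundary hrel, map_one,
      sub_self]

end TorsionFree

/-! ### Central extensions defined by cocycles -/

section CentralExtension

/-- A 2-cocycle on `G` with values in the trivial module `M`. -/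
structure TrivialTwoCocycle (G M : Type*) [Group G] [AddCommGroup M] where
  toFun : G → G → M
  cocycle : ∀ g h k, toFun h k + toFun g (h * k) = toFun (g * h) k + toFun g h

variable {G M : Type*} [Group G] [AddCommGroup M] (β : TrivialTwoCocycle G M)

namespace TrivialTwoCocycle

theorem one_left (g : G) : β.toFun 1 g = β.toFun 1 1 := by
  simpa using β.cocycle 1 1 g

theorem one_right (g : G) : β.toFun g 1 = β.toFun 1 1 := by
  simpa using (β.cocycle g 1 1).symm

end TrivialTwoCocycle

/-- The central extension of `G` by `M` defined by a 2-cocycle, which need not be normalized. -/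
@[ext]
structure CocycleExtension (β : TrivialTwoCocycle G M) where
  fst : M
  snd : G

namespace CocycleExtension

instance : Mul (CocycleExtension β) :=
  ⟨fun x y => ⟨x.fst + y.fst + β.toFun x.snd y.snd, x.snd * y.snd⟩⟩

instance : One (CocycleExtension β) := ⟨⟨-β.toFun 1 1, 1⟩⟩

instance : Inv (CocycleExtension β) :=
  ⟨fun x => ⟨-x.fst - β.toFun x.snd⁻¹ x.snd - β.toFun 1 1, x.snd⁻¹⟩⟩

variable {β}

@[simp] theorem mul_fst (x y : CocycleExtension β) :
    (x * y).fst = x.fst + y.fst + β.toFun x.snd y.snd := rfl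

@[simp] theorem mul_snd (x y : CocycleExtension β) : (x * y).snd = x.snd * y.snd := rfl

@[simp] theorem one_fst : (1 : CocycleExtension β).fst = -β.toFun 1 1 := rfl

@[simp] theorem one_snd : (1 : CocycleExtension β).snd = 1 := rfl

@[simp] theorem inv_fst (x : CocycleExtension β) :
    x⁻¹.fst = -x.fst - β.toFun x.snd⁻¹ x.snd - β.toFun 1 1 := rfl

@[simp] theorem inv_snd (x : CocycleExtension β) : x⁻¹.snd = x.snd⁻¹ := rfl

instance : Group (CocycleExtension β) :=
  Group.ofLeftAxioms
    (fun x y z => by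
      ext
      · have := β.cocycle x.snd y.snd z.snd
        simp only [mul_fst, mul_snd]
        calc _ = x.fst + y.fst + z.fst +
              (β.toFun (x.snd * y.snd) z.snd + β.toFun x.snd y.snd) := by abel
          _ = _ := by rw [← this]; abel
      · simp [mul_assoc])
    (fun x => by
      ext
      · simp [β.one_left]
      · simp)
    (fun x => by
      ext
      · simp only [mul_fst, inv_fst, inv_snd, one_fst]
        abel
      · simp)

variable (β)

/-- The projection of the extension to `G`. -/
def proj : CocycleExtension β →* G where
  toFun := snd
  map_one' := rfl
  map_mul' _ _ := rfl

variable {β}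

theorem mul_fst_of_left {x y : CocycleExtension β} (hx : x.snd = 1) :
    (x * y).fst = (x.fst + β.toFun 1 1) + y.fst := by
  rw [mul_fst, hx, β.one_left]; abel

theorem mul_fst_of_right {x y : CocycleExtension β} (hy : y.snd = 1) :
    (x * y).fst = x.fst + (y.fst + β.toFun 1 1) := by
  rw [mul_fst, hy, β.one_right]; abel

/-- The component in the central subgroup `M` is invariant under conjugation. -/
theorem conj_fst {w x : CocycleExtension β} (hx : x.snd = 1) :
    (w * x * w⁻¹).fst = x.fst := by
  have h1 : (w * x * w⁻¹).snd = 1 := by simp [hx]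
  have h2 := mul_fst_of_left (y := w) h1
  rw [inv_mul_cancel_right, mul_fst_of_right hx, add_comm] at h2
  exact (add_right_cancel (add_right_cancel h2)).symm

end CocycleExtension

end CentralExtension

/-! ### The second homology of balanced perfect groups -/

section SecondHomology

variable {X R G M : Type*} [Group G] [AddCommGroup M]

/-- The exponent sums of a word. -/
noncomputable def exponentSum (X : Type*) : FreeGroup X →* Multiplicative (X →₀ ℤ) :=
  FreeGroup.lift fun x => Multiplicative.ofAdd (Finsupp.single x 1)

/-- The matrix of exponent sums of the generators in the relators. -/
noncomputable def relationMatrix (r : R → FreeGroup X) : (R →₀ ℤ) →ₗ[ℤ] (X →₀ ℤ) :=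
  Finsupp.linearCombination ℤ fun ρ => (exponentSum X (r ρ)).toAdd

theorem exponentSum_surjective (X : Type*) : Function.Surjective (exponentSum X) := by
  suffices h : ∀ v : X →₀ ℤ, ∃ f, (exponentSum X f).toAdd = v from fun v => h v.toAdd
  intro v
  induction v using Finsupp.induction_linear with
  | zero => exact ⟨1, by simp⟩
  | add v w hv hw =>
    obtain ⟨f, rfl⟩ := hv
    obtain ⟨f', rfl⟩ := hw
    exact ⟨f * f', by simp⟩
  | single x n => exact ⟨.of x ^ n, by simp [exponentSum]⟩

/-- The number of occurrences of each relator in a sequence, counted with signs. -/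
noncomputable def relatorCount (X R : Type*) : RelatorSequence X R →* Multiplicative (R →₀ ℤ) :=
  FreeGroup.lift fun p => Multiplicative.ofAdd (Finsupp.single p.2 1)

theorem relationMatrix_relatorCount (r : R → FreeGroup X) (h : RelatorSequence X R) :
    relationMatrix r (relatorCount X R h).toAdd =
      (exponentSum X (RelatorSequence.boundary r h)).toAdd := by
  have : (AddMonoidHom.toMultiplicative (relationMatrix r).toAddMonoidHom).comp
      (relatorCount X R) = (exponentSum X).comp (RelatorSequence.boundary r) := by
    ext p : 1
    simp [relatorCount, relationMatrix]
  exact congrArg Multiplicative.toAdd (DFunLike.congr_fun this h)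

variable {π : FreeGroup X →* G} (hπ : Function.Surjective π)
  {r : R → FreeGroup X} (hker : π.ker = Subgroup.normalClosure (Set.range r))

include hπ hker in
/-- The cokernel of the relation matrix is the abelianization of `G`. -/
theorem relationMatrix_surjective (hG : commutator G = ⊤) :
    Function.Surjective (relationMatrix r) := by
  rw [← LinearMap.range_eq_top]
  let q : FreeGroup X →* Multiplicative ((X →₀ ℤ) ⧸ LinearMap.range (relationMatrix r)) :=
    (AddMonoidHom.toMultiplicative
      (Submodule.mkQ (LinearMap.range (relationMatrix r))).toAddMonoidHom).comp (exponentSum X)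
  have hq : π.ker ≤ q.ker := by
    rw [hker]
    apply Subgroup.normalClosure_le_normal
    rintro _ ⟨ρ, rfl⟩
    apply Multiplicative.toAdd.injective
    exact (Submodule.Quotient.mk_eq_zero _).mpr ⟨.single ρ 1, by simp [relationMatrix]⟩
  let q' := MonoidHom.liftOfSurjective π hπ ⟨q, hq⟩
  have hq' : ∀ f, q' (π f) = q f := MonoidHom.liftOfRightInverse_comp_apply _ _ _ ⟨q, hq⟩
  have htriv : ∀ g, q' g = 1 := fun g =>
    Abelianization.commutator_subset_ker q' (hG ▸ Subgroup.mem_top g)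
  rw [Submodule.eq_top_iff']
  intro v
  obtain ⟨f, hf⟩ := exponentSum_surjective X (Multiplicative.ofAdd v)
  have h1 : q f = 1 := by rw [← hq', htriv]
  rw [← Submodule.Quotient.mk_eq_zero]
  have h2 : q f = Multiplicative.ofAdd (Submodule.Quotient.mk v) := by
    simp only [q, MonoidHom.comp_apply, hf]
    rfl
  exact Multiplicative.ofAdd.injective (h2.symm.trans h1)

include hπ hker in
/-- For a balanced presentation of a perfect group, the relation matrix is invertible. -/
theorem relationMatrix_injective [Finite X] (e : R ≃ X) (hG : commutator G = ⊤) :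
    Function.Injective (relationMatrix r) :=
  OrzechProperty.injective_of_surjective_of_injective
    (Finsupp.domLCongr e : (R →₀ ℤ) ≃ₗ[ℤ] (X →₀ ℤ)).toLinearMap (relationMatrix r)
    (Finsupp.domLCongr e).injective (relationMatrix_surjective hπ hker hG)

variable (β : TrivialTwoCocycle G M)

/-- The lift of a free group over `G` to a central extension of `G`. -/
def freeLiftExtension (π : FreeGroup X →* G) : FreeGroup X →* CocycleExtension β :=
  FreeGroup.lift fun x => ⟨0, π (.of x)⟩

@[simp] theorem freeLiftExtension_snd (f : FreeGroup X) :
    (freeLiftExtension β π f).snd = π f := by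
  have : (CocycleExtension.proj β).comp (freeLiftExtension β π) = π := by
    ext x; simp [freeLiftExtension, CocycleExtension.proj]
  exact DFunLike.congr_fun this f

/-- The restriction of the lift to the kernel of `FreeGroup X → G`, with values in the central
subgroup `M`. -/
def freeLiftKer (f : FreeGroup X) : M :=
  (freeLiftExtension β π f).fst + β.toFun 1 1

theorem freeLiftKer_mul {f f' : FreeGroup X} (hf : π f = 1) :
    freeLiftKer β (π := π) (f * f') = freeLiftKer β (π := π) f + freeLiftKer β (π := π) f' := by
  unfold freeLiftKer
  rw [map_mul, CocycleExtension.mul_fst_of_left (by simp [hf])]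
  abel

@[simp] theorem freeLiftKer_one : freeLiftKer β (π := π) 1 = 0 := by
  simp [freeLiftKer]

include hker in
/-- A relator sequence whose boundary has trivial exponent sums has central lift zero, if the
relation matrix is injective. -/
theorem freeLiftKer_eq_zero (hinj : Function.Injective (relationMatrix r)) {f : FreeGroup X}
    (hf : π f = 1) (hf0 : exponentSum X f = 1) : freeLiftKer β (π := π) f = 0 := by
  have hrel := map_relator_eq_one hker
  have hmem : f ∈ (RelatorSequence.boundary r).range := by
    rw [RelatorSequence.range_boundary, ← hker]
    exact hf
  obtain ⟨h, rfl⟩ := hmem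
  let Λ : RelatorSequence X R →* Multiplicative M :=
    MonoidHom.mk'
      (fun h => Multiplicative.ofAdd (freeLiftKer β (π := π) (RelatorSequence.boundary r h)))
      fun h k => by rw [map_mul, freeLiftKer_mul β (map_boundary hrel h), ofAdd_add]
  let L : (R →₀ ℤ) →+ M := Finsupp.liftAddHom fun ρ =>
    zmultiplesHom M (freeLiftKer β (π := π) (r ρ))
  have hΛ : Λ = (AddMonoidHom.toMultiplicative L).comp (relatorCount X R) := by
    ext ⟨w, ρ⟩
    have h1 : freeLiftKer β (π := π) (w * r ρ * w⁻¹) = freeLiftKer β (π := π) (r ρ) := by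
      unfold freeLiftKer
      rw [map_mul, map_mul, map_inv, CocycleExtension.conj_fst (by simp [hrel])]
    simp [Λ, L, relatorCount, h1]
  have hcount : (relatorCount X R h).toAdd = 0 := by
    apply hinj
    rw [relationMatrix_relatorCount, hf0]
    simp
  have h2 := DFunLike.congr_fun hΛ h
  have h3 : Multiplicative.ofAdd (freeLiftKer β (π := π) (RelatorSequence.boundary r h)) =
      Multiplicative.ofAdd (L (relatorCount X R h).toAdd) := h2
  rw [hcount, map_zero] at h3
  exact Multiplicative.ofAdd.injective h3

include hπ in
/-- Every 2-chain `c` is carried by an element of the kernel of `FreeGroup X → G`, whose exponent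
sums are determined by the boundary of `c`. -/
theorem exists_freeLiftKer_eq (c : G × G →₀ ℤ) :
    ∃ f : FreeGroup X, π f = 1 ∧
      (exponentSum X f).toAdd = Finsupp.liftAddHom (fun g : G =>
        zmultiplesHom _ (exponentSum X (Function.surjInv hπ g)).toAdd)
          (c.sum fun p n => .single p.1 n + .single p.2 n - .single (p.1 * p.2) n) ∧
      freeLiftKer β (π := π) f = c.sum (fun p n => n • β.toFun p.1 p.2) +
        Finsupp.liftAddHom (fun g : G =>
          zmultiplesHom _ (freeLiftExtension β π (Function.surjInv hπ g)).fst)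
          (c.sum fun p n => .single p.1 n + .single p.2 n - .single (p.1 * p.2) n) := by
  induction c using Finsupp.induction_linear with
  | zero => exact ⟨1, by simp⟩
  | add c d hc hd =>
    obtain ⟨f, hf, hf1, hf2⟩ := hc
    obtain ⟨f', hf', hf1', hf2'⟩ := hd
    have hadd : ∀ p : G × G, ∀ m n : ℤ,
        (.single p.1 (m + n) + .single p.2 (m + n) - .single (p.1 * p.2) (m + n) : G →₀ ℤ) =
        (.single p.1 m + .single p.2 m - .single (p.1 * p.2) m) +
        (.single p.1 n + .single p.2 n - .single (p.1 * p.2) n) := by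
      intro p m n
      simp only [Finsupp.single_add]
      abel
    refine ⟨f * f', by simp [hf, hf'], ?_, ?_⟩
    · rw [Finsupp.sum_add_index' (by simp) hadd, map_add, map_mul, toAdd_mul, hf1, hf1']
    · rw [Finsupp.sum_add_index' (h := fun (p : G × G) (n : ℤ) => n • β.toFun p.1 p.2) (by simp)
          (by simp [add_smul]), Finsupp.sum_add_index' (by simp) hadd, map_add,
        freeLiftKer_mul β hf, hf2, hf2']
      abel
  | single p n =>
    obtain ⟨g, h⟩ := p
    set f := Function.surjInv hπ g * Function.surjInv hπ h * (Function.surjInv hπ (g * h))⁻¹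
      with hf
    have hf1 : π f = 1 := by simp [hf, Function.surjInv_eq]
    have hfker : freeLiftKer β (π := π) f = β.toFun g h +
        (freeLiftExtension β π (Function.surjInv hπ g)).fst +
        (freeLiftExtension β π (Function.surjInv hπ h)).fst -
        (freeLiftExtension β π (Function.surjInv hπ (g * h))).fst := by
      have h1 : freeLiftExtension β π (Function.surjInv hπ g) *
          freeLiftExtension β π (Function.surjInv hπ h) =
          freeLiftExtension β π f * freeLiftExtension β π (Function.surjInv hπ (g * h)) := by
        simp [hf]
      have h2 := congrArg CocycleExtension.fst h1
      rw [CocycleExtension.mul_fst_of_left (x := freeLiftExtension β π f) (by simp [hf1]),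
        CocycleExtension.mul_fst] at h2
      simp only [freeLiftExtension_snd, Function.surjInv_eq] at h2
      rw [freeLiftKer, eq_sub_iff_add_eq, ← h2]
      abel
    have hpow : ∀ k : ℤ, freeLiftKer β (π := π) (f ^ k) = k • freeLiftKer β (π := π) f := by
      let Λ : Subgroup.zpowers f →* Multiplicative M :=
        MonoidHom.mk' (fun x => Multiplicative.ofAdd (freeLiftKer β (π := π) (x : FreeGroup X)))
          fun x y => by
            have hx : π (x : FreeGroup X) = 1 := by
              obtain ⟨k, hk⟩ := x.2
              rw [← hk]
              simp [hf1]
            rw [Subgroup.coe_mul, freeLiftKer_mul β hx, ofAdd_add]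
      intro k
      exact congrArg Multiplicative.toAdd (map_zpow Λ ⟨f, Subgroup.mem_zpowers f⟩ k)
    refine ⟨f ^ n, by simp [hf1], ?_, ?_⟩
    · rw [Finsupp.sum_single_index (by simp)]
      simp only [hf, map_zpow, map_mul, map_inv, toAdd_zpow, toAdd_mul, toAdd_inv, map_add, map_sub,
        Finsupp.liftAddHom_apply_single, zmultiplesHom_apply, smul_add, smul_neg]
      abel
    · rw [hpow, hfker, Finsupp.sum_single_index (by simp), Finsupp.sum_single_index (by simp)]
      simp only [map_add, map_sub, Finsupp.liftAddHom_apply_single, zmultiplesHom_apply, smul_add,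
        smul_sub]
      abel

include hπ hker in
/-- If a perfect group has a balanced presentation, then every 2-cocycle with trivial
coefficients vanishes on every 2-cycle. -/
theorem sum_cocycle_eq_zero [Finite X] (e : R ≃ X) (hG : commutator G = ⊤) {c : G × G →₀ ℤ}
    (hc : (c.sum fun p n => .single p.1 n + .single p.2 n - .single (p.1 * p.2) n : G →₀ ℤ) = 0) :
    c.sum (fun p n => n • β.toFun p.1 p.2) = 0 := by
  obtain ⟨f, hf, hf1, hf2⟩ := exists_freeLiftKer_eq hπ β c
  rw [hc, map_zero] at hf1 hf2
  rw [add_zero] at hf2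
  rw [← hf2]
  exact freeLiftKer_eq_zero hker β (relationMatrix_injective hπ hker e hG) hf
    (Multiplicative.toAdd.injective hf1)

open groupHomology in
/-- A perfect group with a balanced presentation has trivial Schur multiplier. -/
theorem subsingleton_groupHomology_two {X R G : Type} [Group G] [Finite X]
    {π : FreeGroup X →* G} (hπ : Function.Surjective π) {r : R → FreeGroup X}
    (hker : π.ker = Subgroup.normalClosure (Set.range r)) (e : R ≃ X) (hG : commutator G = ⊤) :
    Subsingleton (groupHomology (Rep.trivial ℤ G ℤ) 2) := by
  let β : TrivialTwoCocycle G ((G × G →₀ ℤ) ⧸ boundaries₂ (Rep.trivial ℤ G ℤ)) :=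
    { toFun := fun g h => Submodule.Quotient.mk (.single (g, h) 1)
      cocycle := fun g h k => by
        rw [← Submodule.Quotient.mk_add, ← Submodule.Quotient.mk_add, Submodule.Quotient.eq]
        refine ⟨.single (g, h, k) (1 : ℤ), ?_⟩
        refine (d₃₂_single (A := Rep.trivial ℤ G ℤ) (g, h, k) (1 : ℤ)).trans ?_
        rw [Representation.IsTrivial.out, LinearMap.id_apply]
        dsimp only
        abel }
  refine subsingleton_of_forall_eq 0 fun y => ?_
  induction y using H2_induction_on with
  | h c =>
    rw [H2π_eq_zero_iff]
    obtain ⟨c, hc⟩ := c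
    have h1 := sum_cocycle_eq_zero hπ hker β e hG (c := c) (by
      rw [mem_cycles₂_iff] at hc
      simp only [Representation.IsTrivial.out, LinearMap.id_apply] at hc
      rw [Finsupp.sum_sub, sub_eq_zero, ← hc]
      exact Finsupp.sum_congr fun p _ => add_comm _ _)
    have h2 : (Submodule.mkQ (boundaries₂ (Rep.trivial ℤ G ℤ))) =
        Finsupp.linearCombination ℤ fun p : G × G => β.toFun p.1 p.2 := by
      refine Finsupp.lhom_ext' fun p => LinearMap.ext_ring ?_
      simp [β]
    rw [← Finsupp.linearCombination_apply, ← h2] at h1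
    exact (Submodule.Quotient.mk_eq_zero _).mp h1

end SecondHomology

/-! ### The Baumslag–Solitar group `BS(2,3)` -/

section BaumslagSolitar

theorem BS23.relation : BS23.t * PresentedGroup.of BSGen.a ^ 2 * BS23.t⁻¹ =
    (PresentedGroup.of BSGen.a ^ 3 : BS23) := by
  rw [← mul_inv_eq_one]
  exact PresentedGroup.one_of_mem (rels := {FreeGroup.of BSGen.t * FreeGroup.of BSGen.a ^ 2 *
    (FreeGroup.of BSGen.t)⁻¹ * (FreeGroup.of BSGen.a ^ 3)⁻¹}) rfl

/-- The generator `a` of `BS(2,3)`. -/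
def BS23.a : BS23 := PresentedGroup.of BSGen.a

/-- The homomorphism from `BS(2,3)` determined by two elements satisfying the relation. -/
def BS23.lift {H : Type*} [Group H] (x y : H) (h : y * x ^ 2 * y⁻¹ = x ^ 3) : BS23 →* H :=
  PresentedGroup.toGroup (f := fun g => match g with | .a => x | .t => y) (by
    rintro _ rfl
    simp [h])

variable {H : Type*} [Group H] {x y : H} (h : y * x ^ 2 * y⁻¹ = x ^ 3)

@[simp] theorem BS23.lift_a : BS23.lift x y h BS23.a = x := PresentedGroup.toGroup.of _

@[simp] theorem BS23.lift_t : BS23.lift x y h BS23.t = y := PresentedGroup.toGroup.of _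

theorem BS23.hom_ext {f f' : BS23 →* H} (ha : f BS23.a = f' BS23.a) (ht : f BS23.t = f' BS23.t) :
    f = f' :=
  PresentedGroup.ext fun g => match g with | .a => ha | .t => ht

/-- The exponent sum of `t`. -/
def BS23.degree : BS23 →* Multiplicative ℤ :=
  BS23.lift 1 (Multiplicative.ofAdd 1) (by simp)

theorem BS23.not_isOfFinOrder_t : ¬ IsOfFinOrder BS23.t := by
  intro h
  have := BS23.degree.isOfFinOrder h
  rw [BS23.degree, BS23.lift_t, isOfFinOrder_ofAdd_iff, isOfFinAddOrder_iff_nsmul_eq_zero] at this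
  obtain ⟨n, hn, h0⟩ := this
  simp at h0
  omega

/-- The element `a` has infinite order, because it acts on `ℚ` as `x ↦ x + 1` in the action where
`t` acts as `x ↦ 3 x / 2`. -/
theorem BS23.not_isOfFinOrder_a : ¬ IsOfFinOrder BS23.a := by
  let f : BS23 →* Equiv.Perm ℚ :=
    BS23.lift (Equiv.addRight 1) (Equiv.mulLeft₀ (3 / 2) (by norm_num)) (by
      ext x
      simp [pow_succ, Equiv.Perm.mul_apply]
      ring)
  intro h
  have h1 := f.isOfFinOrder h
  rw [BS23.lift_a, isOfFinOrder_iff_pow_eq_one] at h1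
  obtain ⟨n, hn, h0⟩ := h1
  have hpow : ∀ k : ℕ, ((Equiv.addRight (1 : ℚ)) ^ k) 0 = k := fun k => by
    induction k with
    | zero => simp
    | succ k ih => rw [pow_succ', Equiv.Perm.mul_apply, ih]; simp
  have h1 := hpow n
  rw [h0] at h1
  have h2 : (0 : ℚ) = n := h1
  exact hn.ne' (by exact_mod_cast h2.symm)

theorem powMonoidHom_int_injective {k : ℕ} (hk : k ≠ 0) :
    Function.Injective (powMonoidHom k : Multiplicative ℤ →* Multiplicative ℤ) := by
  intro x y h
  apply Multiplicative.toAdd.injective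
  have := congrArg Multiplicative.toAdd h
  simpa [hk] using this

/-- The isomorphism `2ℤ ≃ 3ℤ` defining `BS(2,3)` as an HNN extension of `ℤ`. -/
noncomputable def BS23.stableEquiv :
    (powMonoidHom 2 : Multiplicative ℤ →* Multiplicative ℤ).range ≃*
      (powMonoidHom 3 : Multiplicative ℤ →* Multiplicative ℤ).range :=
  (MonoidHom.ofInjective (powMonoidHom_int_injective two_ne_zero)).symm.trans
    (MonoidHom.ofInjective (powMonoidHom_int_injective three_ne_zero))

theorem BS23.stableEquiv_apply (z : Multiplicative ℤ) :
    (BS23.stableEquiv ⟨z ^ 2, z, rfl⟩ : Multiplicative ℤ) = z ^ 3 := by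
  have : (⟨z ^ 2, z, rfl⟩ : (powMonoidHom 2 : Multiplicative ℤ →* Multiplicative ℤ).range) =
      MonoidHom.ofInjective (powMonoidHom_int_injective two_ne_zero) z := rfl
  rw [this, BS23.stableEquiv, MulEquiv.trans_apply, MulEquiv.symm_apply_apply]
  rfl

/-- By Britton's lemma `t a t⁻¹` and `a` do not commute. -/
theorem BS23.not_commute : BS23.t * BS23.a * BS23.t⁻¹ * BS23.a ≠
    BS23.a * (BS23.t * BS23.a * BS23.t⁻¹) := by
  let z : Multiplicative ℤ := Multiplicative.ofAdd 1
  let f : BS23 →* HNNExtension (Multiplicative ℤ) _ _ BS23.stableEquiv :=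
    BS23.lift (HNNExtension.of z) HNNExtension.t (by
      have := HNNExtension.equiv_eq_conj (φ := BS23.stableEquiv) ⟨z ^ 2, z, rfl⟩
      rw [BS23.stableEquiv_apply, map_pow] at this
      rw [this, map_pow])
  have h2 : ∀ k : ℤ, Multiplicative.ofAdd k ∈
      (powMonoidHom 2 : Multiplicative ℤ →* Multiplicative ℤ).range → (2 : ℤ) ∣ k := by
    rintro k ⟨w, hw⟩
    exact ⟨w.toAdd, by simpa using (congrArg Multiplicative.toAdd hw).symm⟩
  have h3 : ∀ k : ℤ, Multiplicative.ofAdd k ∈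
      (powMonoidHom 3 : Multiplicative ℤ →* Multiplicative ℤ).range → (3 : ℤ) ∣ k := by
    rintro k ⟨w, hw⟩
    exact ⟨w.toAdd, by simpa using (congrArg Multiplicative.toAdd hw).symm⟩
  let w : HNNExtension.NormalWord.ReducedWord (Multiplicative ℤ)
      (powMonoidHom 2 : Multiplicative ℤ →* Multiplicative ℤ).range
      (powMonoidHom 3 : Multiplicative ℤ →* Multiplicative ℤ).range :=
    { head := 1
      toList := [(1, Multiplicative.ofAdd 1), (-1, Multiplicative.ofAdd 1),
        (1, Multiplicative.ofAdd (-1)), (-1, Multiplicative.ofAdd (-1))]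
      chain := by
        simp only [List.isChain_cons_cons, List.isChain_singleton, and_true]
        refine ⟨fun h => ?_, fun h => ?_, fun h => ?_⟩
        · have := h2 _ h
          omega
        · have := h3 _ h
          omega
        · have := h2 _ h
          omega }
  intro h
  have hf := congrArg f h
  simp only [map_mul, map_inv, f, BS23.lift_a, BS23.lift_t] at hf
  have hw : w.prod BS23.stableEquiv = 1 := by
    have hz : Multiplicative.ofAdd (-1 : ℤ) = z⁻¹ := rfl
    simp only [HNNExtension.NormalWord.ReducedWord.prod, w, hz, List.map_cons, List.map_nil,
      List.prod_cons, List.prod_nil, map_one, map_inv, one_mul, mul_one, Units.val_one, zpow_one,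
      Units.val_neg, zpow_neg]
    change HNNExtension.t * HNNExtension.of z * (HNNExtension.t⁻¹ * HNNExtension.of z * _) = _
    simp only [← mul_assoc] at hf ⊢
    rw [hf]
    group
  have := HNNExtension.ReducedWord.toList_eq_nil_of_mem_of_range BS23.stableEquiv w
    (hw ▸ one_mem _)
  simp [w] at this

/-- In a group with a homomorphism to `ℤ` sending `a` to `0` and `t` to `1`, the Fox derivative
`t (1 + a) - (1 + a + a²)` of `t a² t⁻¹ a⁻³` with respect to `a` is not a right zero divisor:
its component of highest degree is `t (1 + a)`, and a finitely supported `z` with `z t (1 + a) = 0`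
has a support invariant under right translation by `t a⁻¹ t⁻¹`, an element of infinite order. -/
theorem eq_zero_of_mul_foxDeriv_relator_eq_zero {G : Type*} [Group G] (deg : G →* Multiplicative ℤ)
    {a t : G} (ha : deg a = 1) (ht : deg t = Multiplicative.ofAdd 1) (hinf : ¬ IsOfFinOrder a)
    {y : ℤ[G]}
    (hy : y * (MonoidAlgebra.of ℤ G t * (1 + MonoidAlgebra.of ℤ G a) -
      (1 + MonoidAlgebra.of ℤ G a + MonoidAlgebra.of ℤ G (a ^ 2))) = 0) : y = 0 := by
  have hcoeff : ∀ u, y.coeff (u * t⁻¹) + y.coeff (u * (t * a)⁻¹) -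
      (y.coeff u + y.coeff (u * a⁻¹) + y.coeff (u * (a ^ 2)⁻¹)) = 0 := by
    intro u
    have h1 : y * (MonoidAlgebra.of ℤ G t * (1 + MonoidAlgebra.of ℤ G a) -
        (1 + MonoidAlgebra.of ℤ G a + MonoidAlgebra.of ℤ G (a ^ 2))) =
        y * .single t 1 + y * .single (t * a) 1 -
          (y * .single 1 1 + y * .single a 1 + y * .single (a ^ 2) 1) := by
      rw [mul_add, mul_one, ← map_mul, ← map_one (MonoidAlgebra.of ℤ G)]
      simp only [mul_sub, mul_add]
      rfl
    rw [h1] at hy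
    have := congrArg (fun z : ℤ[G] => z.coeff u) hy
    simpa [-mul_inv_rev] using this
  by_contra hne
  obtain ⟨v, hv, hmax⟩ := y.coeff.support.exists_max_image (fun g => (deg g).toAdd) (by
    rw [Finsupp.support_nonempty_iff]
    exact fun h => hne (MonoidAlgebra.coeff_injective h))
  have hzero : ∀ u, (deg v).toAdd < (deg u).toAdd → y.coeff u = 0 := fun u hu => by
    by_contra h
    exact absurd (hmax u (Finsupp.mem_support_iff.mpr h)) (not_le.mpr hu)
  -- the part of the support of maximal degree is invariant under right translation by `t a⁻¹ t⁻¹`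
  have hstep : ∀ u, y.coeff u ≠ 0 → deg u = deg v →
      y.coeff (u * (t * a⁻¹ * t⁻¹)) ≠ 0 := fun u hu hd => by
    have h1 := hcoeff (u * t)
    rw [hzero (u * t) (by simp [hd, ht]), hzero (u * t * a⁻¹) (by simp [hd, ht, ha]),
      hzero (u * t * (a ^ 2)⁻¹) (by simp [hd, ht, ha]), mul_inv_cancel_right] at h1
    have h2 : u * t * (t * a)⁻¹ = u * (t * a⁻¹ * t⁻¹) := by group
    rw [h2] at h1
    intro h3
    apply hu
    rw [h3] at h1
    simpa using h1
  have hpow : ∀ k : ℕ, y.coeff (v * (t * a⁻¹ * t⁻¹) ^ k) ≠ 0 ∧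
      deg (v * (t * a⁻¹ * t⁻¹) ^ k) = deg v := fun k => by
    induction k with
    | zero => simpa using hv
    | succ k ih =>
      rw [pow_succ, ← mul_assoc]
      refine ⟨hstep _ ih.1 ih.2, ?_⟩
      rw [map_mul, ih.2]
      simp [ha]
  have hinj : Function.Injective fun k : ℕ => v * (t * a⁻¹ * t⁻¹) ^ k := by
    intro k l hkl
    have h1 := mul_left_cancel hkl
    rw [conj_pow, conj_pow] at h1
    have h2 := mul_left_cancel (mul_right_cancel h1)
    rw [inv_pow, inv_pow, inv_inj] at h2
    exact (injective_pow_iff_not_isOfFinOrder.mpr hinf) h2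
  exact Set.infinite_of_injective_forall_mem hinj
    (fun k => Finsupp.mem_support_iff.mpr (hpow k).1) y.coeff.support.finite_toSet

end BaumslagSolitar

/-! ### Fox derivatives and homomorphisms -/

section FoxNaturality

variable {X X' G G' : Type*} [Group G] [Group G'] (j : X → X') (φ : G →* G')

/-- The map on 1-chains of Cayley complexes induced by a map of generators and a homomorphism of
groups. -/
noncomputable def chainMap : (X →₀ ℤ[G]) →+ (X' →₀ ℤ[G']) :=
  (Finsupp.mapDomain.addMonoidHom j).comp
    (Finsupp.mapRange.addMonoidHom (MonoidAlgebra.mapDomainRingHom ℤ φ).toAddMonoidHom)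

theorem chainMap_single (x : X) (c : ℤ[G]) :
    chainMap j φ (.single x c) = .single (j x) (MonoidAlgebra.mapDomainRingHom ℤ φ c) := by
  simp [chainMap]

theorem mapDomainRingHom_of (g : G) :
    MonoidAlgebra.mapDomainRingHom ℤ φ (MonoidAlgebra.of ℤ G g) = MonoidAlgebra.of ℤ G' (φ g) := by
  simp

theorem chainMap_smul (g : G) (v : X →₀ ℤ[G]) :
    chainMap j φ (MonoidAlgebra.of ℤ G g • v) = MonoidAlgebra.of ℤ G' (φ g) • chainMap j φ v := by
  induction v using Finsupp.induction_linear with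
  | zero => simp
  | add v w hv hw => rw [smul_add, map_add, hv, hw, map_add, smul_add]
  | single x c =>
    rw [Finsupp.smul_single, chainMap_single, chainMap_single, Finsupp.smul_single, smul_eq_mul,
      smul_eq_mul, map_mul, mapDomainRingHom_of]

theorem chainMap_apply_of_notMem_range (v : X →₀ ℤ[G]) {x' : X'} (hx : x' ∉ Set.range j) :
    chainMap j φ v x' = 0 := by
  exact Finsupp.mapDomain_of_notMem_range _ _ hx

theorem chainMap_apply (hj : Function.Injective j) (v : X →₀ ℤ[G]) (x : X) :
    chainMap j φ v (j x) = MonoidAlgebra.mapDomainRingHom ℤ φ (v x) := by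
  exact Finsupp.mapDomain_apply hj _ _

variable {j φ} {π : FreeGroup X →* G} {π' : FreeGroup X' →* G'}

theorem foxDeriv_map (h : ∀ x, π' (.of (j x)) = φ (π (.of x))) (f : FreeGroup X) :
    foxDeriv π' (FreeGroup.map j f) = chainMap j φ (foxDeriv π f) := by
  have hπ : ∀ f, π' (FreeGroup.map j f) = φ (π f) := by
    have : π'.comp (FreeGroup.map j) = φ.comp π := by
      ext x; simp [h]
    exact fun f => DFunLike.congr_fun this f
  induction f using FreeGroup.induction_on with
  | C1 => simp
  | of x => rw [FreeGroup.map.of, foxDeriv_of, foxDeriv_of, chainMap_single, map_one]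
  | inv_of x h => rw [map_inv, foxDeriv_inv, h, hπ, foxDeriv_inv, map_neg, chainMap_smul, map_inv φ]
  | mul x y hx hy => rw [map_mul, foxDeriv_mul, hx, hy, hπ, foxDeriv_mul, map_add, chainMap_smul]

end FoxNaturality

/-! ### Restriction of group ring elements to cosets -/

section CosetRestriction

variable {H G : Type*} [Group H] [Group G] {φ : H →* G} (hφ : Function.Injective φ)

/-- The restriction of an element of `ℤ[G]` to the left coset of `q` with respect to a subgroup `H`,
seen as an element of `ℤ[H]`. -/
noncomputable def cosetRestriction (q : G) : ℤ[G] →+ ℤ[H] :=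
  MonoidAlgebra.comapDomainAddMonoidHom (fun h => q * φ h) ((mul_right_injective q).comp hφ)

theorem coeff_cosetRestriction (q : G) (x : ℤ[G]) (h : H) :
    (cosetRestriction hφ q x).coeff h = x.coeff (q * φ h) := by
  simp [cosetRestriction]

/-- Restriction to a left coset of `H` is linear over `ℤ[H]` acting on the right. -/
theorem cosetRestriction_mul (q : G) (x : ℤ[G]) (c : ℤ[H]) :
    cosetRestriction hφ q (x * MonoidAlgebra.mapDomainRingHom ℤ φ c) =
      cosetRestriction hφ q x * c := by
  induction c using MonoidAlgebra.induction_linear with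
  | zero => simp
  | add c d hc hd => rw [map_add, mul_add, map_add, hc, hd, mul_add]
  | single h n =>
    ext k
    rw [coeff_cosetRestriction]
    simp [coeff_cosetRestriction, mul_assoc]

theorem eq_zero_of_cosetRestriction_eq_zero {x : ℤ[G]}
    (hx : ∀ q, cosetRestriction hφ q x = 0) : x = 0 := by
  ext q
  have := coeff_cosetRestriction hφ q x 1
  rw [hx, map_one φ, mul_one] at this
  exact this.symm

end CosetRestriction

/-! ### Finite presentations -/

namespace FinPresentation

variable {G : Type*} [Group G] (P : FinPresentation G)

/-- The projection of the free group on the generators of a presentation. -/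
def proj : FreeGroup (Fin P.numGens) →* G :=
  P.iso.toMonoidHom.comp (PresentedGroup.mk _)

theorem proj_surjective : Function.Surjective P.proj :=
  P.iso.surjective.comp (PresentedGroup.mk_surjective _)

theorem ker_proj : P.proj.ker = Subgroup.normalClosure (Set.range P.rel) := by
  ext f
  rw [MonoidHom.mem_ker, ← PresentedGroup.mk_eq_one_iff]
  exact P.iso.map_eq_one_iff

theorem proj_of (i : Fin P.numGens) : P.proj (.of i) = P.iso (.of i) := rfl

theorem proj_rel (i : Fin P.numRels) : P.proj (P.rel i) = 1 :=
  map_relator_eq_one P.ker_proj i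

/-- The homomorphism from a presented group determined by the images of the generators. -/
def lift {H : Type*} [Group H] (f : Fin P.numGens → H)
    (h : ∀ i, FreeGroup.lift f (P.rel i) = 1) : G →* H :=
  (PresentedGroup.toGroup (f := f) (rels := Set.range P.rel) (by rintro _ ⟨i, rfl⟩; exact h i)).comp
    P.iso.symm.toMonoidHom

theorem lift_proj {H : Type*} [Group H] (f : Fin P.numGens → H)
    (h : ∀ i, FreeGroup.lift f (P.rel i) = 1) (w : FreeGroup (Fin P.numGens)) :
    P.lift f h (P.proj w) = FreeGroup.lift f w := by
  have : (P.lift f h).comp P.proj = FreeGroup.lift f := by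
    ext i
    simp [lift, proj_of]
  exact DFunLike.congr_fun this w

theorem hom_ext {H : Type*} [Group H] {f f' : G →* H}
    (h : ∀ i, f (P.proj (.of i)) = f' (P.proj (.of i))) : f = f' := by
  have : f.comp P.proj = f'.comp P.proj := by
    ext i; exact h i
  ext g
  obtain ⟨w, rfl⟩ := P.proj_surjective g
  exact DFunLike.congr_fun this w

end FinPresentation

/-! ### The amalgam and its universal property -/

namespace AmalgamQ

variable {B : Type} [Group B] (b : B)

/-- The inclusion of `BS(2,3)` in the amalgam. -/
def inl : BS23 →* AmalgamQ b := Monoid.PushoutI.of (φ := amalgamMap b) false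

/-- The inclusion of `B` in the amalgam. -/
def inr : B →* AmalgamQ b := Monoid.PushoutI.of (φ := amalgamMap b) true

theorem inl_t : inl b BS23.t = inr b b := by
  have h1 := Monoid.PushoutI.of_apply_eq_base (amalgamMap b) false (Multiplicative.ofAdd 1)
  have h2 := Monoid.PushoutI.of_apply_eq_base (amalgamMap b) true (Multiplicative.ofAdd 1)
  have h3 : amalgamMap b false (Multiplicative.ofAdd 1) = BS23.t := zpow_one BS23.t
  have h4 : amalgamMap b true (Multiplicative.ofAdd 1) = b := zpow_one _
  rw [h3] at h1
  rw [h4] at h2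
  exact h1.trans h2.symm

variable {b} {H : Type*} [Group H]

/-- The universal property of the amalgam. -/
def lift (f : BS23 →* H) (g : B →* H) (h : f BS23.t = g b) : AmalgamQ b →* H :=
  Monoid.PushoutI.lift (φ := amalgamMap b)
    (fun i => match i with
      | false => f
      | true => g)
    (zpowersHom H (g b)) (by
      rintro (_ | _)
      · refine MonoidHom.ext_mint ?_
        change f (BS23.t ^ (1 : ℤ)) = g b ^ (1 : ℤ)
        rw [zpow_one, zpow_one, h]
      · refine MonoidHom.ext_mint ?_
        change g (b ^ (1 : ℤ)) = g b ^ (1 : ℤ)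
        rw [zpow_one, zpow_one])

@[simp] theorem lift_inl (f : BS23 →* H) (g : B →* H) (h : f BS23.t = g b) (x : BS23) :
    lift f g h (inl b x) = f x :=
  Monoid.PushoutI.lift_of _ _ _ _

@[simp] theorem lift_inr (f : BS23 →* H) (g : B →* H) (h : f BS23.t = g b) (x : B) :
    lift f g h (inr b x) = g x :=
  Monoid.PushoutI.lift_of _ _ _ _

theorem hom_ext {f f' : AmalgamQ b →* H} (h1 : f.comp (inl b) = f'.comp (inl b))
    (h2 : f.comp (inr b) = f'.comp (inr b)) : f = f' := by
  refine Monoid.PushoutI.hom_ext_nonempty ?_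
  rintro (_ | _)
  · exact h1
  · exact h2

theorem amalgamMap_injective (hb : ¬ IsOfFinOrder b) (i : Bool) :
    Function.Injective (amalgamMap b i) := by
  cases i
  · intro x y h
    exact Multiplicative.toAdd.injective
      (injective_zpow_iff_not_isOfFinOrder.mpr BS23.not_isOfFinOrder_t h)
  · intro x y h
    exact Multiplicative.toAdd.injective (injective_zpow_iff_not_isOfFinOrder.mpr hb h)

theorem inl_injective (hb : ¬ IsOfFinOrder b) : Function.Injective (inl b) :=
  Monoid.PushoutI.of_injective (amalgamMap_injective hb) false

theorem inr_injective (hb : ¬ IsOfFinOrder b) : Function.Injective (inr b) :=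
  Monoid.PushoutI.of_injective (amalgamMap_injective hb) true

end AmalgamQ

/-! ### The presentation of the amalgam and its quotients -/

namespace AmalgamQ

variable {B : Type} [Group B] {b : B} (P : FinPresentation B)
  (w : FreeGroup (Fin P.numGens))

/-- The relators of the presentation `⟨X, a | R, w a² w⁻¹ a⁻³⟩` of the amalgam, where `⟨X | R⟩` is a
presentation of `B` and the word `w` represents `b`; the generator `t` has been eliminated. -/
def rel : Fin (P.numRels + 1) → FreeGroup (Fin (P.numGens + 1)) :=
  Fin.lastCases
    (FreeGroup.map Fin.castSucc w * .of (Fin.last _) ^ 2 * (FreeGroup.map Fin.castSucc w)⁻¹ *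
      (.of (Fin.last _) ^ 3)⁻¹)
    (fun i => FreeGroup.map Fin.castSucc (P.rel i))

@[simp] theorem rel_last : rel P w (Fin.last _) =
    FreeGroup.map Fin.castSucc w * .of (Fin.last _) ^ 2 * (FreeGroup.map Fin.castSucc w)⁻¹ *
      (.of (Fin.last _) ^ 3)⁻¹ := by
  simp [rel]

@[simp] theorem rel_castSucc (i : Fin P.numRels) :
    rel P w i.castSucc = FreeGroup.map Fin.castSucc (P.rel i) := by
  simp [rel]

/-- The images in the amalgam of the generators of its presentation. -/
def gen (b : B) : Fin (P.numGens + 1) → AmalgamQ b :=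
  Fin.lastCases (inl b BS23.a) (fun i => inr b (P.proj (.of i)))

@[simp] theorem gen_last : gen P b (Fin.last _) = inl b BS23.a := by
  simp [gen]

@[simp] theorem gen_castSucc (i : Fin P.numGens) :
    gen P b i.castSucc = inr b (P.proj (.of i)) := by
  simp [gen]

theorem lift_gen_map (f : FreeGroup (Fin P.numGens)) :
    FreeGroup.lift (gen P b) (FreeGroup.map Fin.castSucc f) = inr b (P.proj f) := by
  have : (FreeGroup.lift (gen P b)).comp (FreeGroup.map Fin.castSucc) = (inr b).comp P.proj := by
    ext i; simp
  exact DFunLike.congr_fun this f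

variable {w}

theorem inr_mul_inl_relation : inr b b * inl b BS23.a ^ 2 * (inr b b)⁻¹ = inl b BS23.a ^ 3 := by
  rw [← inl_t, ← map_pow, ← map_inv, ← map_mul, ← map_mul, ← map_pow]
  exact congrArg _ BS23.relation

theorem lift_gen_rel (hw : P.proj w = b) (i : Fin (P.numRels + 1)) :
    FreeGroup.lift (gen P b) (rel P w i) = 1 := by
  induction i using Fin.lastCases with
  | last =>
    rw [rel_last, map_mul, map_mul, map_mul, map_inv, map_inv, lift_gen_map, hw, map_pow, map_pow,
      FreeGroup.lift_apply_of, gen_last, inr_mul_inl_relation, mul_inv_cancel]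
  | cast i => rw [rel_castSucc, lift_gen_map, P.proj_rel, map_one]

/-- The map from the presented group to the amalgam. -/
def fromPresented (hw : P.proj w = b) : PresentedGroup (Set.range (rel P w)) →* AmalgamQ b :=
  PresentedGroup.toGroup (f := gen P b) (by rintro _ ⟨i, rfl⟩; exact lift_gen_rel P hw i)

theorem lift_of_castSucc (f : FreeGroup (Fin P.numGens)) :
    FreeGroup.lift (fun i : Fin P.numGens =>
      (PresentedGroup.of i.castSucc : PresentedGroup (Set.range (rel P w)))) f =
      PresentedGroup.mk _ (FreeGroup.map Fin.castSucc f) := by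
  have : FreeGroup.lift (fun i : Fin P.numGens =>
      (PresentedGroup.of i.castSucc : PresentedGroup (Set.range (rel P w)))) =
      (PresentedGroup.mk _).comp (FreeGroup.map Fin.castSucc) := by
    ext i; simp [PresentedGroup.of]
  exact DFunLike.congr_fun this f

/-- The map from `B` to the presented group. -/
def baseToPresented (w : FreeGroup (Fin P.numGens)) :
    B →* PresentedGroup (Set.range (rel P w)) :=
  P.lift (fun i => PresentedGroup.of i.castSucc) fun i => by
    rw [lift_of_castSucc, ← rel_castSucc P w]
    exact PresentedGroup.one_of_mem (Set.mem_range_self _)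

theorem baseToPresented_proj (f : FreeGroup (Fin P.numGens)) :
    baseToPresented P w (P.proj f) = PresentedGroup.mk _ (FreeGroup.map Fin.castSucc f) := by
  rw [baseToPresented, P.lift_proj, lift_of_castSucc]

/-- The map from the amalgam to the presented group. -/
def toPresented (hw : P.proj w = b) : AmalgamQ b →* PresentedGroup (Set.range (rel P w)) :=
  lift (BS23.lift (.of (Fin.last _)) (PresentedGroup.mk _ (FreeGroup.map Fin.castSucc w)) (by
      rw [← mul_inv_eq_one]
      have := PresentedGroup.one_of_mem (Set.mem_range_self (f := rel P w) (Fin.last _))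
      rw [rel_last] at this
      exact this))
    (baseToPresented P w) (by rw [BS23.lift_t, ← hw, baseToPresented_proj])

/-- The presentation `⟨X, a | R, w a² w⁻¹ a⁻³⟩` of the amalgam. -/
def presentation (hw : P.proj w = b) : FinPresentation (AmalgamQ b) where
  numGens := P.numGens + 1
  numRels := P.numRels + 1
  rel := rel P w
  iso := MonoidHom.toMulEquiv (fromPresented P hw) (toPresented P hw)
    (by
      refine PresentedGroup.ext fun i => ?_
      induction i using Fin.lastCases with
      | last => simp [fromPresented, toPresented]
      | cast i =>
        simp only [fromPresented, toPresented, MonoidHom.comp_apply, PresentedGroup.toGroup.of,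
          gen_castSucc, lift_inr, baseToPresented_proj, FreeGroup.map.of]
        rfl)
    (by
      refine hom_ext (BS23.hom_ext ?_ ?_) (P.hom_ext fun i => ?_)
      · simp [fromPresented, toPresented]
      · simp only [MonoidHom.comp_apply, toPresented, lift_inl, BS23.lift_t, MonoidHom.id_apply]
        refine (lift_gen_map P w).trans ?_
        rw [hw, inl_t]
      · simp only [MonoidHom.comp_apply, toPresented, lift_inr, baseToPresented_proj,
          MonoidHom.id_apply]
        exact lift_gen_map P (.of i))

theorem foxDeriv_map_castSucc (f : FreeGroup (Fin P.numGens)) :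
    foxDeriv (FreeGroup.lift (gen P b)) (FreeGroup.map Fin.castSucc f) =
      chainMap Fin.castSucc (inr b) (foxDeriv P.proj f) :=
  foxDeriv_map (fun i => by rw [FreeGroup.lift_apply_of, gen_castSucc]) f

theorem foxDeriv_map_castSucc_last (f : FreeGroup (Fin P.numGens)) :
    foxDeriv (FreeGroup.lift (gen P b)) (FreeGroup.map Fin.castSucc f) (Fin.last _) = 0 := by
  rw [foxDeriv_map_castSucc]
  exact chainMap_apply_of_notMem_range _ _ _ (by
    rintro ⟨i, hi⟩
    exact (Fin.castSucc_lt_last i).ne hi)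

/-- The derivative of the relator `w a² w⁻¹ a⁻³` with respect to `a`. -/
theorem foxDeriv_rel_last (hw : P.proj w = b) :
    foxDeriv (FreeGroup.lift (gen P b)) (rel P w (Fin.last _)) (Fin.last _) =
      MonoidAlgebra.mapDomainRingHom ℤ (inl b)
        (MonoidAlgebra.of ℤ _ BS23.t * (1 + MonoidAlgebra.of ℤ _ BS23.a) -
          (1 + MonoidAlgebra.of ℤ _ BS23.a + MonoidAlgebra.of ℤ _ (BS23.a ^ 2))) := by
  have h1 : FreeGroup.lift (gen P b) (FreeGroup.map Fin.castSucc w) = inl b BS23.t := by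
    rw [lift_gen_map, hw, inl_t]
  have ha : FreeGroup.lift (gen P b) (.of (Fin.last _)) = inl b BS23.a := by
    rw [FreeGroup.lift_apply_of, gen_last]
  have hD : foxDeriv (FreeGroup.lift (gen P b)) (FreeGroup.map Fin.castSucc w) (Fin.last _) = 0 :=
    foxDeriv_map_castSucc_last P w
  have hDa : foxDeriv (FreeGroup.lift (gen P b)) (.of (Fin.last _)) (Fin.last _) = 1 := by
    rw [foxDeriv_of, Finsupp.single_eq_same]
  rw [rel_last]
  generalize (FreeGroup.of (Fin.last P.numGens)) = a at *
  generalize FreeGroup.map Fin.castSucc w = u at *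
  have h2 : FreeGroup.lift (gen P b) (u * a ^ 2) = FreeGroup.lift (gen P b) (a ^ 3 * u) := by
    rw [map_mul, map_mul, map_pow, map_pow, h1, ha, ← map_pow, ← map_pow, ← map_mul, ← map_mul]
    exact congrArg _ (mul_inv_eq_iff_eq_mul.mp BS23.relation)
  have h3 : u * a ^ 2 * u⁻¹ * (a ^ 3)⁻¹ = (u * a ^ 2) * (a ^ 3 * u)⁻¹ := by group
  rw [h3, foxDeriv_mul_inv _ h2]
  simp only [foxDeriv_mul, pow_succ, pow_zero, one_mul, Finsupp.add_apply, Finsupp.sub_apply,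
    Finsupp.smul_apply, hD, hDa, map_mul, map_add, map_sub, mapDomainRingHom_of, h1, ha, map_one,
    smul_eq_mul, mul_zero, mul_one, mul_add, zero_add, add_zero]

/-- The second boundary operator of the presentation is injective if the one of `B` is. The Jacobian
matrix is block triangular, with the Jacobian matrix of `B` and the derivative of the last relator
as diagonal blocks. -/
theorem foxBoundaryTwo_injective (hb : ¬ IsOfFinOrder b) (hw : P.proj w = b)
    (hP : Function.Injective (foxBoundaryTwo P.proj P.rel)) :
    Function.Injective (foxBoundaryTwo (FreeGroup.lift (gen P b)) (rel P w)) := by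
  rw [injective_iff_map_eq_zero]
  intro v hv
  have hsum : ∀ x, ∑ i : Fin P.numRels, v i.castSucc *
        foxDeriv (FreeGroup.lift (gen P b)) (rel P w i.castSucc) x +
      v (Fin.last _) * foxDeriv (FreeGroup.lift (gen P b)) (rel P w (Fin.last _)) x = 0 := by
    intro x
    have := DFunLike.congr_fun hv x
    rw [foxBoundaryTwo, Finsupp.linearCombination_apply, Finsupp.sum_fintype _ _ (by simp),
      Fin.sum_univ_castSucc] at this
    simpa [Finsupp.finsetSum_apply] using this
  have hlast : v (Fin.last _) = 0 := by
    refine eq_zero_of_cosetRestriction_eq_zero (inl_injective hb) fun q => ?_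
    have h1 := hsum (Fin.last _)
    simp only [rel_castSucc, foxDeriv_map_castSucc_last, mul_zero, Finset.sum_const_zero, zero_add,
      foxDeriv_rel_last P hw] at h1
    refine eq_zero_of_mul_foxDeriv_relator_eq_zero BS23.degree (a := BS23.a) (t := BS23.t)
      (BS23.lift_a _) (BS23.lift_t _) BS23.not_isOfFinOrder_a ?_
    rw [← cosetRestriction_mul, h1, map_zero]
  have hinit : ∀ i : Fin P.numRels, v i.castSucc = 0 := by
    intro i
    refine eq_zero_of_cosetRestriction_eq_zero (inr_injective hb) fun q => ?_
    let u : Fin P.numRels →₀ ℤ[B] := Finsupp.equivFunOnFinite.symm fun i =>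
      cosetRestriction (inr_injective hb) q (v i.castSucc)
    have hu : foxBoundaryTwo P.proj P.rel u = 0 := by
      ext1 x
      have h1 := congrArg (cosetRestriction (inr_injective hb) q) (hsum x.castSucc)
      simp only [hlast, zero_mul, add_zero, rel_castSucc, foxDeriv_map_castSucc,
        chainMap_apply _ _ (Fin.castSucc_injective _), map_sum, cosetRestriction_mul,
        map_zero] at h1
      rw [foxBoundaryTwo, Finsupp.linearCombination_apply, Finsupp.sum_fintype _ _ (by simp)]
      simpa [Finsupp.finsetSum_apply, u] using h1
    have h0 : u = 0 := hP (hu.trans (map_zero _).symm)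
    exact DFunLike.congr_fun h0 i
  ext1 i
  induction i using Fin.lastCases with
  | last => exact hlast
  | cast i => exact hinit i

theorem presentation_isAspherical (hb : ¬ IsOfFinOrder b) (hw : P.proj w = b)
    (hP : P.IsAspherical) : (presentation P hw).IsAspherical :=
  isAsphericalPresentation_of_injective (presentation P hw).proj_surjective
    (presentation P hw).ker_proj
    (foxBoundaryTwo_injective P hb hw
      (IsAsphericalPresentation.foxBoundaryTwo_injective P.proj_surjective P.ker_proj hP))

/-- The endomorphism `a ↦ a²`, identical on `B`, is surjective, since `a³ = t a² t⁻¹` is in its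
image; it kills the commutator of `t a t⁻¹` and `a`. -/
theorem isNonHopfian (hb : ¬ IsOfFinOrder b) : IsNonHopfian (AmalgamQ b) := by
  have hrel : BS23.t * BS23.a ^ 2 * BS23.t⁻¹ = BS23.a ^ 3 := BS23.relation
  let s : BS23 →* BS23 := BS23.lift (BS23.a ^ 2) BS23.t (by
    rw [sq (BS23.a ^ 2), ← conj_mul, hrel, ← pow_add, ← pow_mul])
  let f : AmalgamQ b →* AmalgamQ b :=
    lift ((inl b).comp s) (inr b) (by simp [s, inl_t])
  have hfa : f (inl b BS23.a) = inl b BS23.a ^ 2 := by simp [f, s]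
  have hft : f (inl b BS23.t) = inl b BS23.t := by simp [f, s]
  refine ⟨f, ?_, ?_⟩
  · rw [← MonoidHom.range_eq_top]
    have h2 : inl b BS23.a ^ 2 ∈ f.range := ⟨_, hfa⟩
    have ht : inl b BS23.t ∈ f.range := ⟨_, hft⟩
    have h3 : inl b BS23.a ^ 3 ∈ f.range := by
      rw [← map_pow, ← hrel, map_mul, map_mul, map_inv, map_pow]
      exact mul_mem (mul_mem ht h2) (inv_mem ht)
    have ha : inl b BS23.a ∈ f.range := by
      have := mul_mem h3 (inv_mem h2)
      rwa [pow_succ' _ 2, mul_inv_cancel_right] at this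
    have hl : ∀ x, inl b x ∈ f.range := fun x => by
      have : ∀ g : BSGen, (PresentedGroup.of g : BS23) ∈ f.range.comap (inl b) := fun g =>
        match g with
        | .a => ha
        | .t => ht
      exact PresentedGroup.generated_by _ _ this x
    refine eq_top_iff.mpr fun q _ => ?_
    induction q using Monoid.PushoutI.induction_on with
    | of i x =>
      cases i
      · exact hl x
      · exact ⟨inr b x, lift_inr _ _ _ x⟩
    | base z =>
      rw [← Monoid.PushoutI.of_apply_eq_base (amalgamMap b) false]
      exact hl _
    | mul x y hx hy => exact mul_mem (hx trivial) (hy trivial)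
  · intro hker
    have hinj : Function.Injective f := (MonoidHom.ker_eq_bot_iff f).mp hker
    apply BS23.not_commute
    apply inl_injective hb
    apply hinj
    have h1 : inl b BS23.t * inl b BS23.a ^ 2 * (inl b BS23.t)⁻¹ = inl b BS23.a ^ 3 := by
      rw [← map_pow, ← map_inv, ← map_mul, ← map_mul, hrel, map_pow]
    simp only [map_mul, map_inv, hfa, hft, h1]
    rw [← pow_add, ← pow_add]

/-- A homomorphism from the amalgam which is trivial on `B` is trivial, because it kills `t`, so
that `a² = a³` in the image. -/
theorem hom_eq_one_of_inr {H : Type*} [Group H] (f : AmalgamQ b →* H) (h : ∀ x, f (inr b x) = 1) :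
    f = 1 := by
  have ht : f (inl b BS23.t) = 1 := by rw [inl_t, h]
  have ha : f (inl b BS23.a) = 1 := by
    have := congrArg f (inr_mul_inl_relation (b := b))
    rw [map_mul, map_mul, map_inv, h, map_pow, map_pow, one_mul, inv_one, mul_one] at this
    generalize f (inl b BS23.a) = z at this
    rwa [pow_succ' z 2, right_eq_mul] at this
  refine hom_ext (BS23.hom_ext ?_ ?_) ?_
  · simpa using ha
  · simpa using ht
  · ext x
    simpa using h x

theorem noNontrivialFiniteQuotients (hB : NoNontrivialFiniteQuotients B) :
    NoNontrivialFiniteQuotients (AmalgamQ b) := by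
  intro N hN hfin
  let f : AmalgamQ b →* AmalgamQ b ⧸ N := QuotientGroup.mk' N
  let g : B →* AmalgamQ b ⧸ N := f.comp (inr b)
  have hg : Subsingleton (B ⧸ g.ker) := hB g.ker inferInstance
    (Finite.of_injective _ (QuotientGroup.kerLift_injective g))
  have hf : f = 1 := hom_eq_one_of_inr f fun x => by
    have := QuotientGroup.subsingleton_iff.mp hg
    exact MonoidHom.mem_ker.mp (this ▸ Subgroup.mem_top x : x ∈ g.ker)
  refine subsingleton_of_forall_eq 1 fun q => ?_
  obtain ⟨q, rfl⟩ := QuotientGroup.mk_surjective q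
  exact DFunLike.congr_fun hf q

end AmalgamQ

/-! ### Perfectness and the first homology -/

section Perfect

/-- A finitely generated abelian group without proper subgroups of finite index is trivial: it
equals its double, so it is torsion by Nakayama's lemma, hence finite. -/
theorem subsingleton_of_forall_finite_quotient {A : Type*} [AddCommGroup A] [Module.Finite ℤ A]
    (h : ∀ N : Submodule ℤ A, Finite (A ⧸ N) → N = ⊤) : Subsingleton A := by
  let N : Submodule ℤ A := Ideal.span {(2 : ℤ)} • ⊤
  have htors : Module.IsTorsion ℤ (A ⧸ N) := by
    intro x
    obtain ⟨x, rfl⟩ := Submodule.Quotient.mk_surjective N x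
    refine ⟨⟨2, mem_nonZeroDivisors_of_ne_zero two_ne_zero⟩, ?_⟩
    change (2 : ℤ) • (Submodule.Quotient.mk x : A ⧸ N) = 0
    rw [← Submodule.Quotient.mk_smul, Submodule.Quotient.mk_eq_zero]
    exact Submodule.smul_mem_smul (Ideal.subset_span rfl) trivial
  have hN : N = ⊤ := h N (Module.finite_of_fg_torsion _ htors)
  obtain ⟨r, hr, hr0⟩ := Submodule.exists_sub_one_mem_and_smul_eq_zero_of_fg_of_le_smul
    (Ideal.span {(2 : ℤ)}) (⊤ : Submodule ℤ A) Module.Finite.fg_top hN.ge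
  have hr1 : r ≠ 0 := by
    rintro rfl
    rw [Ideal.mem_span_singleton] at hr
    omega
  have hfin : Finite A := Module.finite_of_fg_torsion A fun x =>
    ⟨⟨r, mem_nonZeroDivisors_of_ne_zero hr1⟩, hr0 x trivial⟩
  have hbot : (⊥ : Submodule ℤ A) = ⊤ :=
    h ⊥ (Finite.of_surjective _ (Submodule.Quotient.mk_surjective _))
  exact (Submodule.subsingleton_iff ℤ).mp (subsingleton_of_bot_eq_top hbot)

theorem NoNontrivialFiniteQuotients.commutator_eq_top {G : Type*} [Group G] [Group.FG G]
    (hG : NoNontrivialFiniteQuotients G) : commutator G = ⊤ := by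
  have hfg : Group.FG (Abelianization G) :=
    Group.fg_of_surjective (f := Abelianization.of) QuotientGroup.mk_surjective
  have hfin : Module.Finite ℤ (Additive (Abelianization G)) :=
    Module.Finite.iff_addGroup_fg.mpr inferInstance
  have hsub : Subsingleton (Additive (Abelianization G)) := by
    refine subsingleton_of_forall_finite_quotient fun N hN => ?_
    let g : G →* Multiplicative (Additive (Abelianization G) ⧸ N) :=
      (AddMonoidHom.toMultiplicativeRight N.mkQ.toAddMonoidHom).comp Abelianization.of
    have hg : Subsingleton (G ⧸ g.ker) := hG g.ker inferInstance
      (Finite.of_injective _ (QuotientGroup.kerLift_injective g))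
    have hker := QuotientGroup.subsingleton_iff.mp hg
    rw [Submodule.eq_top_iff']
    intro x
    obtain ⟨y, hy⟩ := QuotientGroup.mk_surjective x.toMul
    have h1 : y ∈ g.ker := hker ▸ Subgroup.mem_top y
    have h2 : (Submodule.Quotient.mk x : Additive (Abelianization G) ⧸ N) = 0 := by
      have h3 : x = Additive.ofMul (Abelianization.of y) := hy.symm
      rw [h3]
      exact MonoidHom.mem_ker.mp h1
    exact (Submodule.Quotient.mk_eq_zero N).mp h2
  rw [← Abelianization.ker_of, eq_top_iff]
  intro x _
  exact hsub.elim (Additive.ofMul (Abelianization.of x)) 0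

theorem FinPresentation.group_fg {G : Type*} [Group G] (P : FinPresentation G) : Group.FG G :=
  Group.fg_of_surjective P.proj_surjective

theorem subsingleton_groupHomology_one {G : Type} [Group G] (hG : commutator G = ⊤) :
    Subsingleton (groupHomology (Rep.trivial ℤ G ℤ) 1) := by
  have : Subsingleton (Abelianization G) := QuotientGroup.subsingleton_iff.mpr hG
  have : Subsingleton (Additive (Abelianization G)) := this
  exact (groupHomology.H1AddEquivOfIsTrivial (Rep.trivial ℤ G ℤ)).toEquiv.subsingleton

end Perfect

theorem proposition4p3 (B : Type) [Group B]
    (hB : ∃ P : FinPresentation B, P.IsBalanced ∧ P.IsAspherical)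
    (hBfin : NoNontrivialFiniteQuotients B)
    (b : B) (hb : ¬ IsOfFinOrder b) :
    IsNonHopfian (AmalgamQ b) ∧
      (∃ P : FinPresentation (AmalgamQ b), P.IsBalanced ∧ P.IsAspherical) ∧
      NoNontrivialFiniteQuotients (AmalgamQ b) ∧
      (∀ q : AmalgamQ b, IsOfFinOrder q → q = 1) ∧
      Subsingleton (groupHomology (Rep.trivial ℤ (AmalgamQ b) ℤ) 1) ∧
      Subsingleton (groupHomology (Rep.trivial ℤ (AmalgamQ b) ℤ) 2) := by
  obtain ⟨P, hbal, hasph⟩ := hB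
  obtain ⟨w, hw⟩ := P.proj_surjective b
  let P' := AmalgamQ.presentation P hw
  have hbal' : P'.IsBalanced := congrArg (· + 1) hbal
  have hasph' : P'.IsAspherical := AmalgamQ.presentation_isAspherical P hb hw hasph
  have hfin := AmalgamQ.noNontrivialFiniteQuotients (b := b) hBfin
  have := P'.group_fg
  have hperf := hfin.commutator_eq_top
  exact ⟨AmalgamQ.isNonHopfian hb, ⟨P', hbal', hasph'⟩, hfin,
    IsAsphericalPresentation.eq_one_of_isOfFinOrder P'.proj_surjective P'.ker_proj hasph',
    subsingleton_groupHomology_one hperf,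
    subsingleton_groupHomology_two P'.proj_surjective P'.ker_proj (finCongr hbal'.symm) hperf⟩
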